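/- Let $K$ be a field of characteristic different from $2$ and $3$. Algebras are not assumed to be associative or to have a unit; for an element $x$ of a commutative algebra, $L_x$ denotes the operator of multiplication by $x$ and $x^3=(xx)x$. An algebra is nilpotent of index $m$ if $m$ is the least positive integer such that every product of $m$ or more elements (with any bracketing) is zero, and it is locally nilpotent if each of its finitely generated subalgebras is nilpotent. (1) Every commutative $K$-algebra satisfying the identity $L_x^3=\tfrac12 L_{x^3}$ is locally nilpotent. (2) More precisely, let $k\ge 0$ be an integer. The free commutative $K$-algebra on $k$ generators satisfying the identity $x^3=0$ is nilpotent; let $n$ be its index of nilpotency. Let $\dim[n,k]$ be the dimension of the subspace of the free commutative (nonassociative, non-unital) $K$-algebra on $k$ generators that is spanned by the monomials of degree less than $n$, that is, the number of commutative nonassociative monomials of degree less than $n$ in $k$ variables. Then every commutative $K$-algebra that is generated by $k$ elements and satisfies $L_x^3=\tfrac12 L_{x^3}$ is nilpotent of index at most $2^{4n\dim[n,k]}$. -/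

import Mathlib

universe u v w

/-! ### Nilpotency of algebras that need not be associative -/

/-- Every product of at least `m` factors from `A`, with any arrangement of brackets, is zero. -/
def ProductsVanish (A : Type u) [Mul A] [Zero A] (m : ℕ) : Prop :=
  ∀ p : FreeMagma A, m ≤ p.length → FreeMagma.lift (id : A → A) p = 0

/-- `m` is the index of nilpotency of `A`: the least positive integer such that all products of
`m` or more factors vanish. -/
def IsNilpotencyIndex (A : Type u) [Mul A] [Zero A] (m : ℕ) : Prop :=
  IsLeast {j : ℕ | 1 ≤ j ∧ ProductsVanish A j} m

/-- `A` is nilpotent. -/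
def IsNilpotentAlgebra (A : Type u) [Mul A] [Zero A] : Prop :=
  ∃ m : ℕ, IsNilpotencyIndex A m

/-- `A` is locally nilpotent: every finitely generated subalgebra is nilpotent. -/
def IsLocallyNilpotentAlgebra (K : Type u) (A : Type v) [Field K] [NonUnitalNonAssocCommRing A]
    [Module K A] [IsScalarTower K A A] [SMulCommClass K A A] : Prop :=
  ∀ s : Finset A, IsNilpotentAlgebra (NonUnitalAlgebra.adjoin K (s : Set A))

/-- `A` is generated, as a non-unital algebra over `K`, by `k` elements. -/
def IsGeneratedBy (K : Type u) (A : Type v) [Field K] [NonUnitalNonAssocCommRing A]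
    [Module K A] [IsScalarTower K A A] [SMulCommClass K A A] (k : ℕ) : Prop :=
  ∃ g : Fin k → A, NonUnitalAlgebra.adjoin K (Set.range g) = ⊤

/-- The identity `L_x ^ 3 = (1 / 2) L_{x ^ 3}` between operators on `A`, where `L_x` is left
multiplication by `x`. -/
def SatisfiesHalfCubeIdentity (K : Type u) (A : Type v) [Field K] [NonUnitalNonAssocCommRing A]
    [Module K A] [IsScalarTower K A A] [SMulCommClass K A A] : Prop :=
  ∀ x : A, LinearMap.mulLeft K x ^ 3 = (1 / 2 : K) • LinearMap.mulLeft K (x * x * x)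

/-! ### The free commutative algebra -/

/-- The multiplicative congruence on nonassociative words generated by commutativity. -/
def commCon (X : Type u) : Con (FreeMagma X) :=
  conGen fun a b => ∃ p q : FreeMagma X, a = p * q ∧ b = q * p

/-- The commutative nonassociative monomials (of degree at least one) in the variables `X`. -/
def CommMonomial (X : Type u) : Type u := (commCon X).Quotient

instance CommMonomial.instCommMagma (X : Type u) : CommMagma (CommMonomial X) where
  mul := ((inferInstance : Mul (commCon X).Quotient)).mul
  mul_comm a b := by
    induction a using Con.induction_on with
    | H p =>
      induction b using Con.induction_on with
      | H q => exact (Con.eq (commCon X)).2 (ConGen.Rel.of _ _ ⟨p, q, rfl, rfl⟩)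

theorem commCon_length {X : Type u} {p q : FreeMagma X} (h : commCon X p q) :
    p.length = q.length := by
  have h' : ConGen.Rel (fun a b => ∃ p q : FreeMagma X, a = p * q ∧ b = q * p) p q := h
  induction h' with
  | of a b hab =>
    obtain ⟨p, q, rfl, rfl⟩ := hab
    exact Nat.add_comm p.length q.length
  | refl a => rfl
  | symm _ ih => exact (ih ‹_›).symm
  | trans _ _ ih₁ ih₂ => exact (ih₁ ‹_›).trans (ih₂ ‹_›)
  | mul _ _ ih₁ ih₂ => exact congrArg₂ (· + ·) (ih₁ ‹_›) (ih₂ ‹_›)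

/-- The degree of a monomial: its number of factors from `X`. -/
def CommMonomial.degree {X : Type u} (m : CommMonomial X) : ℕ :=
  Con.liftOn m FreeMagma.length fun _ _ h => commCon_length h

/-- The free commutative (nonassociative, non-unital) `K`-algebra on `X`: the vector space with
basis the commutative monomials, multiplied bilinearly. -/
abbrev FreeCommAlgebra (K : Type u) (X : Type v) [Field K] : Type (max u v) :=
  MonoidAlgebra K (CommMonomial X)

/-- `dim[n,k]`: the dimension of the subspace of the free commutative algebra on `k` generators
that is spanned by the monomials of degree less than `n`. -/
noncomputable def dimBelow (K : Type u) [Field K] (n k : ℕ) : ℕ :=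
  Module.finrank K (Submodule.span K
    ((fun m : CommMonomial (Fin k) => (MonoidAlgebra.single m 1 : FreeCommAlgebra K (Fin k))) ''
      {m | m.degree < n}))

/-! ### The free commutative algebra with `x ^ 3 = 0` -/

theorem FreeCommAlgebra.mul_comm' {K : Type u} {X : Type v} [Field K]
    (a b : FreeCommAlgebra K X) : a * b = b * a := by
  induction a using MonoidAlgebra.induction_linear with
  | zero => simp
  | add a₁ a₂ h₁ h₂ => rw [add_mul, mul_add, h₁, h₂]
  | single m r =>
    induction b using MonoidAlgebra.induction_linear with
    | zero => simp
    | add b₁ b₂ h₁ h₂ => rw [add_mul, mul_add, h₁, h₂]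
    | single n s =>
      rw [MonoidAlgebra.single_mul_single, MonoidAlgebra.single_mul_single, mul_comm m n,
        mul_comm r s]

/-- The ideal of the free commutative algebra generated by all cubes `(x x) x`: the smallest
subspace that contains them and is closed under multiplication by arbitrary elements. -/
noncomputable def cubeIdeal (K : Type u) (X : Type v) [Field K] : Submodule K (FreeCommAlgebra K X) :=
  sInf {I | (∀ a x, x ∈ I → a * x ∈ I) ∧ ∀ x : FreeCommAlgebra K X, x * x * x ∈ I}

theorem mul_mem_cubeIdeal {K : Type u} {X : Type v} [Field K] (a : FreeCommAlgebra K X)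
    {x : FreeCommAlgebra K X} (hx : x ∈ cubeIdeal K X) : a * x ∈ cubeIdeal K X :=
  Submodule.mem_sInf.2 fun I hI => hI.1 a x (Submodule.mem_sInf.1 hx I hI)

/-- The free commutative `K`-algebra on `X` satisfying the identity `x ^ 3 = 0`. -/
abbrev FreeCubeZeroAlgebra (K : Type u) (X : Type v) [Field K] : Type (max u v) :=
  FreeCommAlgebra K X ⧸ cubeIdeal K X

namespace FreeCubeZeroAlgebra

variable {K : Type u} {X : Type v} [Field K]

noncomputable instance instMul : Mul (FreeCubeZeroAlgebra K X) where
  mul := Quotient.map₂ (· * ·) fun a₁ a₂ ha b₁ b₂ hb => by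
    replace ha := (Submodule.quotientRel_def _).1 ha
    replace hb := (Submodule.quotientRel_def _).1 hb
    refine (Submodule.quotientRel_def _).2 ?_
    have h : a₁ * b₁ - a₂ * b₂ = b₁ * (a₁ - a₂) + a₂ * (b₁ - b₂) := by
      rw [mul_sub, mul_sub, FreeCommAlgebra.mul_comm' b₁ a₁, FreeCommAlgebra.mul_comm' b₁ a₂]
      abel
    rw [h]
    exact add_mem (mul_mem_cubeIdeal _ ha) (mul_mem_cubeIdeal _ hb)

theorem mk_mul (a b : FreeCommAlgebra K X) :
    (Submodule.Quotient.mk (a * b) : FreeCubeZeroAlgebra K X) =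
      Submodule.Quotient.mk a * Submodule.Quotient.mk b := rfl

noncomputable instance instNonUnitalNonAssocCommRing :
    NonUnitalNonAssocCommRing (FreeCubeZeroAlgebra K X) where
  __ := (inferInstance : AddCommGroup (FreeCubeZeroAlgebra K X))
  __ := instMul
  left_distrib := by
    rintro ⟨a⟩ ⟨b⟩ ⟨c⟩
    exact congrArg Submodule.Quotient.mk (mul_add a b c)
  right_distrib := by
    rintro ⟨a⟩ ⟨b⟩ ⟨c⟩
    exact congrArg Submodule.Quotient.mk (add_mul a b c)
  zero_mul := by
    rintro ⟨a⟩
    exact congrArg Submodule.Quotient.mk (zero_mul a)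
  mul_zero := by
    rintro ⟨a⟩
    exact congrArg Submodule.Quotient.mk (mul_zero a)
  mul_comm := by
    rintro ⟨a⟩ ⟨b⟩
    exact congrArg Submodule.Quotient.mk (FreeCommAlgebra.mul_comm' a b)

instance instIsScalarTower :
    IsScalarTower K (FreeCubeZeroAlgebra K X) (FreeCubeZeroAlgebra K X) where
  smul_assoc := by
    rintro r ⟨a⟩ ⟨b⟩
    exact congrArg Submodule.Quotient.mk (smul_mul_assoc r a b)

instance instSMulCommClass :
    SMulCommClass K (FreeCubeZeroAlgebra K X) (FreeCubeZeroAlgebra K X) where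
  smul_comm := by
    rintro r ⟨a⟩ ⟨b⟩
    exact congrArg Submodule.Quotient.mk (mul_smul_comm r a b).symm

end FreeCubeZeroAlgebra

/-!
Order the words in finitely many elements of a special Jordan algebra `J` that is nil of index `3`
by length and then lexicographically. The linearization of `x ^ 3 = 0` rewrites a product of three
elements of `J` with descending leading words as a combination of smaller words. If `u` and `v` are
the leading words of `x` and `y` and `u v > v u`, then `u v` is that of `x y + y x`. By Shirshov's
method, the words that cannot be rewritten have bounded length, so long products vanish. In a
commutative algebra with `x ^ 3 = 0` one has `L_{x y} = -(L_x L_y + L_y L_x)` and `L_x ^ 3 = 0`, so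
the multiplications form such a `J`, and finitely generated algebras of this kind are nilpotent.

If `2 L_x ^ 3 = L_{x ^ 3}`, the cubes span an ideal with square zero, and every monomial of degree
at least `n` lies in it. Consider words in the operators `L_m`, where `m` runs through the
monomials. A word containing a letter three times is a combination of shorter words of at least the
same degree. Hence a word of degree greater than `2 (n - 1) dim[n,k]` is a combination of words with
a letter of degree at least `n`; these map the algebra into the ideal and annihilate the ideal, so
the product of two such words is zero. Finally, a monomial of degree `2 ^ N` is a word of `N`
multiplications applied to some element.
-/

/-! ### Leading words in associative algebras -/

section WordValues

variable {K R ι : Type*} [Field K] [Ring R] [Algebra K R] {f : ι → R}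

/-- The span of the values of the words of length `m` under the substitution `f` of elements of an
algebra for letters. -/
def lengthSpan (K : Type*) {R ι : Type*} [Field K] [Ring R] [Algebra K R] (f : ι → R) (m : ℕ) :
    Submodule K R :=
  Submodule.span K ((fun w : List ι => (w.map f).prod) '' {w | w.length = m})

theorem prod_mem_lengthSpan (w : List ι) : (w.map f).prod ∈ lengthSpan K f w.length :=
  Submodule.subset_span ⟨w, rfl, rfl⟩

theorem mul_mem_lengthSpan {m n : ℕ} {x y : R} (hx : x ∈ lengthSpan K f m)
    (hy : y ∈ lengthSpan K f n) : x * y ∈ lengthSpan K f (m + n) := by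
  have h := Submodule.mul_mem_mul hx hy
  rw [lengthSpan, lengthSpan, Submodule.span_mul_span] at h
  refine Submodule.span_mono ?_ h
  rintro _ ⟨_, ⟨u, rfl, rfl⟩, _, ⟨v, rfl, rfl⟩, rfl⟩
  exact ⟨u ++ v, List.length_append, by simp⟩

theorem lengthSpan_eq_bot {m n : ℕ} (h : ∀ w : List ι, w.length = m → (w.map f).prod = 0)
    (hmn : m ≤ n) : lengthSpan K f n = ⊥ := by
  refine Submodule.span_eq_bot.2 ?_
  rintro _ ⟨w, hw : w.length = n, rfl⟩
  dsimp only
  rw [← List.take_append_drop m w, List.map_append, List.prod_append,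
    h _ (List.length_take_of_le (hmn.trans_eq hw.symm)), zero_mul]

end WordValues

section LeadingWords

variable {ι : Type*} [LinearOrder ι]

theorem append_lt_append_of_length_eq {u v : List ι} (h : u < v) (hl : u.length = v.length)
    (p q : List ι) : u ++ p < v ++ q := by
  induction u generalizing v with
  | nil => simp [List.length_eq_zero_iff.1 hl.symm] at h
  | cons a u ih =>
    cases v with
    | nil => simp at hl
    | cons b v =>
      simp only [List.cons_append, List.cons_lt_cons_iff] at h ⊢
      exact h.imp id fun ⟨hab, huv⟩ => ⟨hab, ih huv (by simpa using hl)⟩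

/-- `u` dominates `v` if the words are equal or the concatenation `u v` is lexicographically larger
than `v u`. Comparing concatenations avoids a convention for prefixes. -/
def Dominates (u v : List ι) : Prop :=
  u = v ∨ v ++ u < u ++ v

theorem append_cons_lt_append_cons {a b : ι} (h : a < b) (p u v : List ι) :
    p ++ a :: u < p ++ b :: v :=
  List.append_left_lt (List.cons_lt_cons_iff.2 (Or.inl h))

theorem swap_lt_of_lt {a b : ι} (h : a < b) (p u v : List ι) :
    (p ++ a :: v) ++ (p ++ b :: u) < (p ++ b :: u) ++ (p ++ a :: v) := by
  simpa using append_cons_lt_append_cons h p (v ++ (p ++ b :: u)) (u ++ (p ++ a :: v))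

variable {K R : Type*} [Field K] [Ring R] [Algebra K R]

/-- The span of the values of the words that have the same length as `w` and precede `w` in the
lexicographic order. -/
def lowerSpan (K : Type*) {R : Type*} [Field K] [Ring R] [Algebra K R] (f : ι → R) (w : List ι) :
    Submodule K R :=
  Submodule.span K ((fun w : List ι => (w.map f).prod) '' {v | v.length = w.length ∧ v < w})

variable {f : ι → R}

theorem prod_mem_lowerSpan {v w : List ι} (hl : v.length = w.length) (h : v < w) :
    (v.map f).prod ∈ lowerSpan K f w :=
  Submodule.subset_span ⟨v, ⟨hl, h⟩, rfl⟩

theorem lowerSpan_le_lengthSpan (w : List ι) : lowerSpan K f w ≤ lengthSpan K f w.length :=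
  Submodule.span_mono (Set.image_mono fun _ h => h.1)

theorem lowerSpan_mono {v w : List ι} (hl : v.length = w.length) (h : v < w) :
    lowerSpan K f v ≤ lowerSpan K f w :=
  Submodule.span_mono (Set.image_mono fun _ hu => ⟨hu.1.trans hl, hu.2.trans h⟩)

theorem mul_mem_lowerSpan_of_left {u v : List ι} {x y : R} (hx : x ∈ lowerSpan K f u)
    (hy : y ∈ lengthSpan K f v.length) : x * y ∈ lowerSpan K f (u ++ v) := by
  have h := Submodule.mul_mem_mul hx hy
  rw [lowerSpan, lengthSpan, Submodule.span_mul_span] at h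
  refine Submodule.span_le.2 ?_ h
  rintro _ ⟨_, ⟨u', hu, rfl⟩, _, ⟨v', hv : v'.length = v.length, rfl⟩, rfl⟩
  simp only [← List.prod_append, ← List.map_append]
  exact prod_mem_lowerSpan (by simp [hu.1, hv]) (append_lt_append_of_length_eq hu.2 hu.1 _ _)

theorem mul_mem_lowerSpan_of_right (u : List ι) {v : List ι} {y : R} (hy : y ∈ lowerSpan K f v) :
    (u.map f).prod * y ∈ lowerSpan K f (u ++ v) := by
  have h := Submodule.mul_mem_mul (Submodule.mem_span_singleton_self (R := K) (u.map f).prod) hy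
  rw [lowerSpan, Submodule.span_mul_span] at h
  refine Submodule.span_le.2 ?_ h
  rintro _ ⟨_, rfl, _, ⟨v', hv, rfl⟩, rfl⟩
  simp only [← List.prod_append, ← List.map_append]
  exact prod_mem_lowerSpan (by simp [hv.1]) (List.append_left_lt hv.2)

/-- `x` is the value of `w` up to smaller words of the same length. -/
def HasLeadingWord (K : Type*) {R : Type*} [Field K] [Ring R] [Algebra K R] (f : ι → R) (x : R)
    (w : List ι) : Prop :=
  x - (w.map f).prod ∈ lowerSpan K f w

/-- The value of `w` is a combination of values of smaller words of the same length. -/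
def IsReducible (K : Type*) {R : Type*} [Field K] [Ring R] [Algebra K R] (f : ι → R)
    (w : List ι) : Prop :=
  (w.map f).prod ∈ lowerSpan K f w

namespace HasLeadingWord

variable {x y : R} {u v w : List ι}

theorem singleton (i : ι) : HasLeadingWord K f (f i) [i] := by
  simp [HasLeadingWord]

theorem mem_lengthSpan (h : HasLeadingWord K f x w) : x ∈ lengthSpan K f w.length := by
  simpa using add_mem (lowerSpan_le_lengthSpan w h) (prod_mem_lengthSpan (K := K) (f := f) w)

theorem mem_lowerSpan (h : HasLeadingWord K f x v) (hl : v.length = w.length) (hlt : v < w) :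
    x ∈ lowerSpan K f w := by
  simpa using add_mem (lowerSpan_mono hl hlt h) (prod_mem_lowerSpan (K := K) (f := f) hl hlt)

theorem mul (hx : HasLeadingWord K f x u) (hy : HasLeadingWord K f y v) :
    HasLeadingWord K f (x * y) (u ++ v) := by
  have h := add_mem (mul_mem_lowerSpan_of_left hx hy.mem_lengthSpan)
    (mul_mem_lowerSpan_of_right u hy)
  rwa [sub_mul, mul_sub, sub_add_sub_cancel, ← List.prod_append, ← List.map_append] at h

theorem add_of_mem (hx : HasLeadingWord K f x w) (hy : y ∈ lowerSpan K f w) :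
    HasLeadingWord K f (x + y) w := by
  rw [HasLeadingWord, add_sub_right_comm]
  exact add_mem hx hy

theorem mul_add_mul (hx : HasLeadingWord K f x u) (hy : HasLeadingWord K f y v)
    (h : v ++ u < u ++ v) : HasLeadingWord K f (x * y + y * x) (u ++ v) :=
  (hx.mul hy).add_of_mem ((hy.mul hx).mem_lowerSpan (by simp [add_comm]) h)

theorem isReducible (hx : HasLeadingWord K f x w) (h : x ∈ lowerSpan K f w) :
    IsReducible K f w := by
  simpa [IsReducible] using sub_mem h hx

end HasLeadingWord

theorem IsReducible.append (u : List ι) {v : List ι} (h : IsReducible K f v) (w : List ι) :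
    IsReducible K f (u ++ v ++ w) := by
  have huv := mul_mem_lowerSpan_of_right u h
  have huvw := mul_mem_lowerSpan_of_left huv (prod_mem_lengthSpan w)
  rwa [← List.prod_append, ← List.prod_append, ← List.map_append, ← List.map_append] at huvw

theorem prod_eq_zero_of_forall_isReducible [Finite ι] {m : ℕ}
    (h : ∀ w : List ι, w.length = m → IsReducible K f w) (w : List ι) (hw : w.length = m) :
    (w.map f).prod = 0 := by
  have hwf : {w : List ι | w.length = m}.WellFoundedOn (· < ·) :=
    (List.finite_length_eq ι m).wellFoundedOn
  refine hwf.induction hw fun w hw ih => (Submodule.mem_bot K).1 (Submodule.span_le.2 ?_ (h w hw))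
  rintro _ ⟨v, ⟨hl, hlt⟩, rfl⟩
  exact ih v (hl.trans hw) hlt

end LeadingWords

section CubeZeroJordan

variable {K R : Type*} [Field K] [Ring R] [Algebra K R]

/-- A subspace of an associative algebra that is closed under the Jordan product `x y + y x` and
consists of elements with vanishing cube: a special Jordan algebra that is nil of index `3`. -/
structure IsCubeZeroJordan (J : Submodule K R) : Prop where
  mul_add_mul_mem : ∀ x ∈ J, ∀ y ∈ J, x * y + y * x ∈ J
  cube_eq_zero : ∀ x ∈ J, x * x * x = 0

namespace IsCubeZeroJordan

variable {J : Submodule K R} {x y z : R}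

theorem sq_polarization (hJ : IsCubeZeroJordan J) (h2 : (2 : K) ≠ 0) (hx : x ∈ J) (hy : y ∈ J) :
    x * x * y + x * y * x + y * x * x = 0 := by
  have hplus := hJ.cube_eq_zero _ (add_mem hx hy)
  have hminus := hJ.cube_eq_zero _ (sub_mem hx hy)
  have hcube := hJ.cube_eq_zero _ hy
  have h : (2 : K) • (x * x * y + x * y * x + y * x * x) =
      (x + y) * (x + y) * (x + y) - (x - y) * (x - y) * (x - y) - 2 • (y * y * y) := by
    rw [two_smul]
    noncomm_ring
  rw [hplus, hminus, hcube, sub_zero, smul_zero, sub_zero] at h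
  exact (smul_eq_zero_iff_right h2).1 h

theorem symmetrization (hJ : IsCubeZeroJordan J) (h2 : (2 : K) ≠ 0) (hx : x ∈ J) (hy : y ∈ J)
    (hz : z ∈ J) :
    x * y * z + x * z * y + y * x * z + y * z * x + z * x * y + z * y * x = 0 := by
  have h := hJ.sq_polarization h2 (add_mem hx hy) hz
  have hxz := hJ.sq_polarization h2 hx hz
  have hyz := hJ.sq_polarization h2 hy hz
  calc _ = (x + y) * (x + y) * z + (x + y) * z * (x + y) + z * (x + y) * (x + y)
        - (x * x * z + x * z * x + z * x * x) - (y * y * z + y * z * y + z * y * y) := by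
        noncomm_ring
    _ = 0 := by rw [h, hxz, hyz, sub_zero, sub_zero]

end IsCubeZeroJordan
end CubeZeroJordan

/-! ### Words without descending triples -/

section AvoidsDescents

variable {ι : Type*}

theorem exists_eq_append_flatMap_cons (c : ι) (w : List ι) :
    ∃ (p : List ι) (bs : List (List ι)), w = p ++ bs.flatMap (List.cons c) ∧ c ∉ p ∧
      ∀ t ∈ bs, c ∉ t := by
  induction w with
  | nil => exact ⟨[], [], by simp⟩
  | cons x w ih =>
    obtain ⟨p, bs, rfl, hp, hbs⟩ := ih
    rcases eq_or_ne c x with rfl | hcx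
    · exact ⟨[], p :: bs, by simp, by simp, by simpa using ⟨hp, hbs⟩⟩
    · exact ⟨x :: p, bs, by simp, by simp [hcx, hp], hbs⟩

theorem length_flatMap_cons_le {bs : List (List ι)} {m : ℕ} (h : ∀ t ∈ bs, t.length < m) (c : ι) :
    (bs.flatMap (List.cons c)).length ≤ bs.length * m := by
  rw [List.length_flatMap, ← smul_eq_mul, ← List.length_map]
  refine List.sum_le_card_nsmul _ _ ?_
  simpa using h

variable [LinearOrder ι] {s : Finset ι} {L G : Set (List ι)} {c : ι}

/-- The words in `G` have their letters in `s` and contain no three consecutive factors from `L`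
in descending order. The set `L` is closed under concatenation of descending pairs, as the set of
leading words of a special Jordan algebra is. -/
structure AvoidsDescents (s : Finset ι) (L G : Set (List ι)) : Prop where
  singleton_mem : ∀ i ∈ s, [i] ∈ L
  append_mem : ∀ u ∈ L, ∀ v ∈ L, v ++ u < u ++ v → u ++ v ∈ L
  mem_alphabet : ∀ w ∈ G, ∀ i ∈ w, i ∈ s
  mem_of_isInfix : ∀ w ∈ G, ∀ v, v <:+: w → v ∈ G
  triple_notMem : ∀ u ∈ L, ∀ v ∈ L, ∀ t ∈ L, Dominates u v → Dominates v t → Dominates u t →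
    u ++ v ++ t ∉ G

namespace AvoidsDescents

theorem cons_mem (h : AvoidsDescents s L G) (hc : c ∈ s) {t : List ι}
    (ht : ∀ i ∈ t, i ∈ s ∧ i < c) : c :: t ∈ L := by
  induction t using List.reverseRecOn with
  | nil => exact h.singleton_mem c hc
  | append_singleton t i ih =>
    simp only [List.mem_append, List.mem_singleton, or_imp, forall_and, forall_eq] at ht
    exact h.append_mem _ (ih fun j hj => ⟨ht.1.1 j hj, ht.2.1 j hj⟩) _ (h.singleton_mem i ht.1.2)
      (swap_lt_of_lt ht.2.2 [] t [])

theorem pairwise_tail (h : AvoidsDescents s L G) (hmax : ∀ i ∈ s, i ≤ c) (hc : c ∈ s)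
    {t : List ι} (hct : c ∉ t) (hG : c :: t ∈ G) : (t ++ [c]).Pairwise (· < ·) := by
  have hs : ∀ i ∈ t, i ∈ s := fun i hi => h.mem_alphabet _ hG i (List.mem_cons_of_mem c hi)
  have hlt : ∀ i ∈ t, i < c := fun i hi =>
    (hmax i (hs i hi)).lt_of_ne (ne_of_mem_of_not_mem hi hct)
  refine List.pairwise_append.2 ⟨List.isChain_iff_pairwise.1 ?_, List.pairwise_singleton _ _,
    by simpa using hlt⟩
  refine List.isChain_iff_forall_rel_of_append_cons_cons.2 fun a b p q hpq => ?_
  subst hpq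
  by_contra! hba
  have hlead : c :: p ∈ L := h.cons_mem hc fun i hi => ⟨hs i (by simp [hi]), hlt i (by simp [hi])⟩
  have hdom (i : ι) (hi : i < c) : Dominates (c :: p) [i] := Or.inr (swap_lt_of_lt hi [] p [])
  refine h.triple_notMem _ hlead [a] (h.singleton_mem a (hs a (by simp))) [b]
    (h.singleton_mem b (hs b (by simp))) (hdom a (hlt a (by simp))) ?_ (hdom b (hlt b (by simp)))
    (h.mem_of_isInfix _ hG _ ⟨[], q, by simp⟩)
  exact hba.eq_or_lt.imp (fun e => by rw [e]) fun hlt => swap_lt_of_lt hlt [] [] []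

end AvoidsDescents

/-- The block of letters that replaces `x` once the maximal block is `c w`: this is `c w` itself
for `x = c`, and otherwise the word that leaves `c w` for `x` where `x` would be inserted. -/
def recode (c : ι) (w : List ι) (x : ι) : List ι :=
  c :: (w.filter (· < x) ++ if x = c then [] else [x])

theorem exists_filter_lt_eq_append {w : List ι} (hw : w.Pairwise (· < ·)) {a b : ι} (hab : a < b)
    (ha : a ∉ w) : ∃ r, w.filter (· < b) = w.filter (· < a) ++ r ∧ ∀ i ∈ r, a < i := by
  induction w with
  | nil => exact ⟨[], by simp⟩
  | cons i w ih =>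
    rw [List.mem_cons, not_or] at ha
    rw [List.pairwise_cons] at hw
    rcases lt_or_gt_of_ne ha.1 with hai | hia
    · have hall : ∀ j ∈ i :: w, a < j := by
        simpa [hai] using fun j hj => hai.trans (hw.1 j hj)
      have hnil : (i :: w).filter (· < a) = [] :=
        List.filter_eq_nil_iff.2 fun j hj => by simpa using (hall j hj).le
      exact ⟨(i :: w).filter (· < b), by rw [hnil, List.nil_append],
        fun j hj => hall j (List.mem_of_mem_filter hj)⟩
    · obtain ⟨r, hr, hlt⟩ := ih hw.2 ha.2
      exact ⟨r, by simp [hia, hia.trans hab, hr], hlt⟩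

theorem recode_self {w : List ι} (hw : ∀ i ∈ w, i < c) : recode c w c = c :: w := by
  simp [recode, List.filter_eq_self.2 fun i hi => decide_eq_true (hw i hi)]

theorem recode_of_lt {w : List ι} {x : ι} (hx : x < c) :
    recode c w x = c :: (w.filter (· < x) ++ [x]) := by
  simp [recode, hx.ne]

-- If the larger letter is `c`, the next letter compared on its side is the `c` that opens the
-- following block; that block exists because the two images have the same length.
theorem flatMap_recode_lt {w : List ι} (hw : w.Pairwise (· < ·)) {p q : List ι}
    (hp : ∀ i ∈ p, i ∉ w) (hq : ∀ i ∈ q, i ≤ c) (h : p < q) (hl : p.length = q.length)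
    (hl' : (p.flatMap (recode c w)).length = (q.flatMap (recode c w)).length) :
    p.flatMap (recode c w) < q.flatMap (recode c w) := by
  induction p generalizing q with
  | nil => simp [List.length_eq_zero_iff.1 hl.symm] at h
  | cons a p ih =>
    obtain _ | ⟨b, q⟩ := q
    · simp at hl
    simp only [List.mem_cons, forall_eq_or_imp] at hp hq
    simp only [List.length_cons, add_left_inj] at hl
    rw [List.flatMap_cons, List.flatMap_cons] at hl' ⊢
    rcases List.cons_lt_cons_iff.1 h with hab | ⟨rfl, hlt⟩
    · obtain ⟨r, hr, har⟩ := exists_filter_lt_eq_append hw hab hp.1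
      obtain ⟨d, v, hd, had⟩ : ∃ d v,
          r ++ ((if b = c then [] else [b]) ++ q.flatMap (recode c w)) = d :: v ∧ a < d := by
        obtain _ | ⟨d, r⟩ := r
        · rcases eq_or_ne b c with rfl | hbc
          · obtain _ | ⟨e, q⟩ := q
            · simp_all [recode, hab.ne]
            · exact ⟨b, _, by rw [if_pos rfl, List.flatMap_cons, recode]; rfl, hab⟩
          · exact ⟨b, q.flatMap (recode c w), by rw [if_neg hbc]; rfl, hab⟩
        · exact ⟨d, _, rfl, har d (by simp)⟩
      rw [recode_of_lt (hab.trans_le hq.1), recode, hr]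
      simp only [List.cons_append, List.append_assoc, hd]
      exact append_cons_lt_append_cons had (c :: _) _ _
    · exact List.append_left_lt (ih hp.2 hq.2 hlt hl (by simpa using hl'))

theorem append_flatMap_recode_lt {w : List ι} (hw : w.Pairwise (· < ·)) {p q : List ι}
    (hp : ∀ i ∈ p, i ∉ w) (hq : ∀ i ∈ q, i ∉ w) (hpc : ∀ i ∈ p, i ≤ c) (hqc : ∀ i ∈ q, i ≤ c)
    (h : q ++ p < p ++ q) :
    q.flatMap (recode c w) ++ p.flatMap (recode c w) <
      p.flatMap (recode c w) ++ q.flatMap (recode c w) := by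
  rw [← List.flatMap_append, ← List.flatMap_append]
  exact flatMap_recode_lt hw (List.forall_mem_append.2 ⟨hq, hp⟩)
    (List.forall_mem_append.2 ⟨hpc, hqc⟩) h (by simp [add_comm]) (by simp [add_comm])

theorem exists_eq_append_cons_of_append_lt {t w : List ι} (ht : ∀ i ∈ t, i < c)
    (hw : ∀ i ∈ w, i < c) (h : t ++ [c] < w ++ [c]) :
    ∃ l a t' b v, t = l ++ a :: t' ∧ w ++ [c] = l ++ b :: v ∧ a < b := by
  induction t generalizing w with
  | nil =>
    obtain _ | ⟨b, w⟩ := w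
    · simp at h
    · have := hw b (by simp)
      simp [List.cons_lt_cons_iff, this.not_gt, this.ne'] at h
  | cons a t ih =>
    obtain _ | ⟨b, w⟩ := w
    · exact ⟨[], a, t, c, [], rfl, rfl, ht a (by simp)⟩
    · simp only [List.mem_cons, forall_eq_or_imp] at ht hw
      rcases List.cons_lt_cons_iff.1 h with hab | ⟨rfl, hlt⟩
      · exact ⟨[], a, t, b, w ++ [c], rfl, rfl, hab⟩
      · obtain ⟨l, d, t', b, v, rfl, hl, hdb⟩ := ih ht.2 hw.2 hlt
        exact ⟨a :: l, d, t', b, v, rfl, congrArg _ hl, hdb⟩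

theorem notMem_and_filter_lt_of_pairwise {l v : List ι} {a b : ι}
    (h : (l ++ b :: v).Pairwise (· < ·)) (hl : ∀ i ∈ l, i < a) (hab : a < b) :
    a ∉ l ++ b :: v ∧ (l ++ b :: v).filter (· < a) = l := by
  have hv : ∀ i ∈ b :: v, a < i := by
    simpa [hab] using fun i hi =>
      hab.trans ((List.pairwise_cons.1 (List.pairwise_append.1 h).2.1).1 i hi)
  constructor
  · rw [List.mem_append, not_or]
    exact ⟨fun ha => (hl a ha).false, fun ha => (hv a ha).false⟩
  · rw [List.filter_append, List.filter_eq_self.2 fun i hi => decide_eq_true (hl i hi),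
      List.filter_eq_nil_iff.2 fun i hi => by simpa using (hv i hi).le, List.append_nil]

theorem append_cons_swap_lt {a b : ι} (hab : a < b) {l q v w : List ι} (hq : w ++ [c] = l ++ b :: q)
    (hwv : w ++ [c] <+: v ++ [c]) (x : List ι) :
    c :: (l ++ a :: x) ++ c :: v < c :: v ++ c :: (l ++ a :: x) := by
  obtain ⟨r, hr⟩ := hwv
  rw [hq] at hr
  have hsplit : c :: v ++ c :: (l ++ a :: x) = c :: l ++ b :: (q ++ r ++ (l ++ a :: x)) := by
    rw [List.append_cons, List.cons_append, ← hr]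
    simp
  rw [hsplit]
  simpa using append_cons_lt_append_cons hab (c :: l) (x ++ c :: v) _

namespace AvoidsDescents

theorem eq_recode_of_append_lt (h : AvoidsDescents s L G) (hc : c ∈ s) {v w t : List ι}
    (hw : (w ++ [c]).Pairwise (· < ·)) (ht : (t ++ [c]).Pairwise (· < ·)) (hv : c :: v ∈ L)
    (hwv : w ++ [c] <+: v ++ [c]) (hlt : t ++ [c] < w ++ [c]) (hG : c :: v ++ c :: t ∈ G) :
    (∃ y ∈ s, y ∉ w ∧ c :: t = recode c w y) ∧ c :: v ++ c :: t ∈ L := by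
  have htc : ∀ i ∈ t, i < c := by simpa using (List.pairwise_append.1 ht).2.2
  have hwc : ∀ i ∈ w, i < c := by simpa using (List.pairwise_append.1 hw).2.2
  have hts : ∀ i ∈ t, i ∈ s := fun i hi => h.mem_alphabet _ hG i (by simp [hi])
  obtain ⟨l, a, t', b, q, rfl, hq, hab⟩ := exists_eq_append_cons_of_append_lt htc hwc hlt
  simp only [List.mem_append, List.mem_cons, or_imp, forall_and, forall_eq] at htc hts
  have hlead (x : List ι) (hx : ∀ i ∈ x, i ∈ s ∧ i < c) : c :: (l ++ a :: x) ∈ L := by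
    refine h.cons_mem hc fun i hi => ?_
    simp only [List.mem_append, List.mem_cons] at hi
    rcases hi with hi | rfl | hi
    exacts [⟨hts.1 i hi, htc.1 i hi⟩, ⟨hts.2.1, htc.2.1⟩, hx i hi]
  rcases List.eq_nil_or_concat t' with rfl | ⟨x, y, rfl⟩
  · have hla : ∀ i ∈ l, i < a := by
      simpa using (List.pairwise_append.1 (List.pairwise_append.1 ht).1).2.2
    obtain ⟨haw, hfilter⟩ := notMem_and_filter_lt_of_pairwise (hq ▸ hw) hla hab
    rw [← hq, List.mem_append, not_or] at haw
    have hnil : [c].filter (· < a) = [] := List.filter_eq_nil_iff.2 (by simpa using htc.2.1.le)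
    rw [← hq, List.filter_append, hnil, List.append_nil] at hfilter
    exact ⟨⟨a, hts.2.1, haw.1, by rw [recode_of_lt htc.2.1, hfilter]⟩,
      h.append_mem _ hv _ (hlead [] (by simp)) (append_cons_swap_lt hab hq hwv [])⟩
  · simp only [List.concat_eq_append, List.mem_append, List.mem_singleton, or_imp, forall_and,
      forall_eq] at htc hts
    refine absurd (h.mem_of_isInfix _ hG _ List.infix_rfl) ?_
    have hsplit : c :: v ++ c :: (l ++ a :: x.concat y) = c :: v ++ c :: (l ++ a :: x) ++ [y] := by
      simp
    rw [hsplit]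
    exact h.triple_notMem _ hv _ (hlead x fun i hi => ⟨hts.2.2.1 i hi, htc.2.2.1 i hi⟩) _
      (h.singleton_mem y hts.2.2.2) (Or.inr (append_cons_swap_lt hab hq hwv x))
      (Or.inr (swap_lt_of_lt htc.2.2.2 [] _ []))
      (Or.inr (swap_lt_of_lt htc.2.2.2 [] _ []))

theorem eq_recode_of_mem (h : AvoidsDescents s L G) (hc : c ∈ s) {w : List ι}
    (hw : (w ++ [c]).Pairwise (· < ·)) (hws : ∀ i ∈ w, i ∈ s) {bs : List (List ι)}
    (hbs : ∀ t ∈ bs, (t ++ [c]).Pairwise (· < ·) ∧ (t = w ∨ t ++ [c] < w ++ [c])) {v : List ι}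
    (hv : c :: v ∈ L) (hwv : w ++ [c] <+: v ++ [c])
    (hG : c :: v ++ bs.flatMap (List.cons c) ∈ G) :
    ∀ t ∈ bs, ∃ y ∈ s, y ∉ w ∧ c :: t = recode c w y := by
  have hwc : ∀ i ∈ w, i < c := by simpa using (List.pairwise_append.1 hw).2.2
  induction bs generalizing v with
  | nil => simp
  | cons t bs ih =>
    rw [List.forall_mem_cons] at hbs ⊢
    rw [List.flatMap_cons, ← List.append_assoc] at hG
    obtain ⟨⟨ht, rfl | hlt⟩, hbs⟩ := hbs
    · exact ⟨⟨c, hc, fun hi => (hwc c hi).false, (recode_self hwc).symm⟩,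
        ih hbs (h.cons_mem hc fun i hi => ⟨hws i hi, hwc i hi⟩) List.prefix_rfl
          (h.mem_of_isInfix _ hG _ ⟨c :: v, [], by simp⟩)⟩
    · obtain ⟨hy, hL⟩ := h.eq_recode_of_append_lt hc hw ht hv hwv hlt
        (h.mem_of_isInfix _ hG _ (List.prefix_append _ _).isInfix)
      exact ⟨hy, ih hbs hL (hwv.trans ⟨t ++ [c], by simp⟩) hG⟩

theorem recode_mem (h : AvoidsDescents s L G) (hmax : ∀ i ∈ s, i ≤ c) (hc : c ∈ s) {w : List ι}
    (hwc : ∀ i ∈ w, i < c) (hws : ∀ i ∈ w, i ∈ s) {y : ι} (hy : y ∈ s) : recode c w y ∈ L := by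
  rcases (hmax y hy).eq_or_lt with rfl | hyc
  · rw [recode_self hwc]
    exact h.cons_mem hc fun i hi => ⟨hws i hi, hwc i hi⟩
  · rw [recode_of_lt hyc]
    refine h.cons_mem hc fun i hi => ?_
    rcases List.mem_append.1 hi with hi | hi
    · have hiw := List.mem_of_mem_filter hi
      exact ⟨hws i hiw, hwc i hiw⟩
    · rw [List.mem_singleton.1 hi]
      exact ⟨hy, hyc⟩

theorem recode_sdiff (h : AvoidsDescents s L G) (hmax : ∀ i ∈ s, i ≤ c) (hc : c ∈ s) {w : List ι}
    (hw : (w ++ [c]).Pairwise (· < ·)) (hws : ∀ i ∈ w, i ∈ s) :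
    AvoidsDescents (s \ w.toFinset)
      {u | (∀ i ∈ u, i ∈ s \ w.toFinset) ∧ u.flatMap (recode c w) ∈ L}
      {u | (∀ i ∈ u, i ∈ s \ w.toFinset) ∧ u.flatMap (recode c w) ∈ G} := by
  have hwc : ∀ i ∈ w, i < c := by simpa using (List.pairwise_append.1 hw).2.2
  have hlt {p q : List ι} (hp : ∀ i ∈ p, i ∈ s \ w.toFinset) (hq : ∀ i ∈ q, i ∈ s \ w.toFinset) :
      q ++ p < p ++ q → q.flatMap (recode c w) ++ p.flatMap (recode c w) <
        p.flatMap (recode c w) ++ q.flatMap (recode c w) :=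
    append_flatMap_recode_lt (List.pairwise_append.1 hw).1
      (fun i hi => by simpa using (Finset.mem_sdiff.1 (hp i hi)).2)
      (fun i hi => by simpa using (Finset.mem_sdiff.1 (hq i hi)).2)
      (fun i hi => hmax i (Finset.mem_sdiff.1 (hp i hi)).1)
      (fun i hi => hmax i (Finset.mem_sdiff.1 (hq i hi)).1)
  have hdom {p q : List ι} (hp : ∀ i ∈ p, i ∈ s \ w.toFinset) (hq : ∀ i ∈ q, i ∈ s \ w.toFinset)
      (hpq : Dominates p q) : Dominates (p.flatMap (recode c w)) (q.flatMap (recode c w)) :=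
    hpq.imp (congrArg _) (hlt hp hq)
  refine ⟨fun y hy => ⟨by simpa using hy, ?_⟩, fun u hu v hv huv => ?_, fun u hu => hu.1,
    fun u hu v hvu => ⟨fun i hi => hu.1 i (hvu.subset hi), ?_⟩,
    fun u hu v hv t ht huv hvt hut => ?_⟩
  · rw [List.flatMap_singleton]
    exact h.recode_mem hmax hc hwc hws (Finset.mem_sdiff.1 hy).1
  · refine ⟨List.forall_mem_append.2 ⟨hu.1, hv.1⟩, ?_⟩
    rw [List.flatMap_append]
    exact h.append_mem _ hu.2 _ hv.2 (hlt hu.1 hv.1 huv)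
  · obtain ⟨p, q, rfl⟩ := hvu
    have hG := hu.2
    rw [List.flatMap_append, List.flatMap_append] at hG
    exact h.mem_of_isInfix _ hG _ ⟨_, _, rfl⟩
  · rintro ⟨-, hG⟩
    rw [List.flatMap_append, List.flatMap_append] at hG
    exact h.triple_notMem _ hu.2 _ hv.2 _ ht.2 (hdom hu.1 hv.1 huv) (hdom hv.1 ht.1 hvt)
      (hdom hu.1 ht.1 hut) hG

theorem length_lt_two_of_nil_cons (h : AvoidsDescents s L G) (hmax : ∀ i ∈ s, i ≤ c) (hc : c ∈ s)
    {bs : List (List ι)} (hG : ([] :: bs).flatMap (List.cons c) ∈ G) : bs.length < 2 := by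
  by_contra! hlen
  obtain ⟨t₁, t₂, bs, rfl⟩ : ∃ t₁ t₂ bs', bs = t₁ :: t₂ :: bs' := by
    match bs, hlen with
    | t₁ :: t₂ :: bs', _ => exact ⟨t₁, t₂, bs', rfl⟩
  obtain ⟨x, r, hx⟩ : ∃ x r, (t₁ :: t₂ :: bs).flatMap (List.cons c) = c :: x :: r := by
    obtain _ | ⟨x, t₁⟩ := t₁
    exacts [⟨c, _, rfl⟩, ⟨x, _, rfl⟩]
  rw [List.flatMap_cons, hx] at hG
  have hxs : x ∈ s := h.mem_alphabet _ hG x (by simp)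
  have hdom : Dominates [c] [x] :=
    (hmax x hxs).eq_or_lt.imp (fun e => by rw [e]) fun hlt => swap_lt_of_lt hlt [] [] []
  have hcL := h.singleton_mem c hc
  exact h.triple_notMem _ hcL _ hcL _ (h.singleton_mem x hxs) (Or.inl rfl) hdom hdom
    (h.mem_of_isInfix _ hG _ ⟨[], r, rfl⟩)

theorem exists_length_tails_lt (h : AvoidsDescents s L G) (hmax : ∀ i ∈ s, i ≤ c) (hc : c ∈ s)
    (ih : ∀ s' : Finset ι, s'.card < s.card → ∀ L' G' : Set (List ι), AvoidsDescents s' L' G' →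
      ∃ N, ∀ w ∈ G', w.length < N)
    {w : List ι} (hw : (w ++ [c]).Pairwise (· < ·)) (hws : ∀ i ∈ w, i ∈ s) :
    ∃ N, ∀ bs : List (List ι),
      (∀ t ∈ bs, (t ++ [c]).Pairwise (· < ·) ∧ (t = w ∨ t ++ [c] < w ++ [c])) →
      (w :: bs).flatMap (List.cons c) ∈ G → bs.length < N := by
  have hwc : ∀ i ∈ w, i < c := by simpa using (List.pairwise_append.1 hw).2.2
  obtain _ | ⟨a, w⟩ := w
  · exact ⟨2, fun _ _ hG => h.length_lt_two_of_nil_cons hmax hc hG⟩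
  · set w := a :: w
    have hcard : (s \ w.toFinset).card < s.card := by
      refine Finset.card_lt_card (Finset.sdiff_ssubset (fun i hi => hws i (by simpa using hi)) ?_)
      exact ⟨a, by simp [w]⟩
    obtain ⟨N, hN⟩ := ih _ hcard _ _ (h.recode_sdiff hmax hc hw hws)
    refine ⟨N, fun bs hbs hG => ?_⟩
    have : Nonempty ι := ⟨c⟩
    choose! y hys hyw hy using h.eq_recode_of_mem hc hw hws hbs
      (h.cons_mem hc fun i hi => ⟨hws i hi, hwc i hi⟩) List.prefix_rfl hG
    have hmem : c :: bs.map y ∈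
        {u | (∀ i ∈ u, i ∈ s \ w.toFinset) ∧ u.flatMap (recode c w) ∈ G} := by
      constructor
      · simp only [List.forall_mem_cons, List.forall_mem_map, Finset.mem_sdiff, List.mem_toFinset]
        exact ⟨⟨hc, fun hi => (hwc c hi).false⟩, fun t ht => ⟨hys t ht, hyw t ht⟩⟩
      · rw [List.flatMap_cons, recode_self hwc, List.flatMap_map,
          ← List.flatMap_congr fun t ht => hy t ht]
        exact hG
    simpa using (Nat.lt_succ_self _).trans (hN _ hmem)

theorem exists_length_blocks_lt (h : AvoidsDescents s L G) (hmax : ∀ i ∈ s, i ≤ c) (hc : c ∈ s)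
    (ih : ∀ s' : Finset ι, s'.card < s.card → ∀ L' G' : Set (List ι), AvoidsDescents s' L' G' →
      ∃ N, ∀ w ∈ G', w.length < N)
    (W : Finset (List ι)) (hW : ∀ t ∈ W, (t ++ [c]).Pairwise (· < ·) ∧ ∀ i ∈ t, i ∈ s) :
    ∃ N, ∀ bs : List (List ι), (∀ t ∈ bs, t ∈ W) → bs.flatMap (List.cons c) ∈ G →
      bs.length < N := by
  induction W using Finset.induction_on_max_value (fun t : List ι => t ++ [c]) with
  | empty => exact ⟨1, fun bs hbs _ => by
      simp [List.eq_nil_iff_forall_not_mem.2 fun t ht => Finset.notMem_empty t (hbs t ht)]⟩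
  | insert w W _ hle ihW =>
    rw [Finset.forall_mem_insert] at hW
    obtain ⟨N₁, hN₁⟩ := ihW hW.2
    obtain ⟨N₂, hN₂⟩ := h.exists_length_tails_lt hmax hc ih hW.1.1 hW.1.2
    have hlt : ∀ t ∈ insert w W, (t ++ [c]).Pairwise (· < ·) ∧ (t = w ∨ t ++ [c] < w ++ [c]) := by
      rw [Finset.forall_mem_insert]
      refine ⟨⟨hW.1.1, Or.inl rfl⟩, fun t ht => ⟨(hW.2 t ht).1, ?_⟩⟩
      exact (hle t ht).eq_or_lt.imp List.append_cancel_right id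
    refine ⟨N₁ + N₂, fun bs hbs hG => ?_⟩
    by_cases hwbs : w ∈ bs
    · obtain ⟨p, q, rfl, hwp⟩ := List.eq_append_cons_of_mem hwbs
      rw [List.flatMap_append] at hG
      have hp := hN₁ p (fun t ht => Finset.mem_of_mem_insert_of_ne (hbs t (by simp [ht]))
        (ne_of_mem_of_not_mem ht hwp)) (h.mem_of_isInfix _ hG _ (List.prefix_append _ _).isInfix)
      have hq := hN₂ q (fun t ht => hlt t (hbs t (by simp [ht])))
        (h.mem_of_isInfix _ hG _ (List.suffix_append _ _).isInfix)
      simp only [List.length_append, List.length_cons]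
      omega
    · exact (hN₁ bs (fun t ht => Finset.mem_of_mem_insert_of_ne (hbs t ht)
        (ne_of_mem_of_not_mem ht hwbs)) hG).trans_le (Nat.le_add_right _ _)

end AvoidsDescents

theorem finite_pairwise_lt_of_subset (s : Finset ι) :
    {t : List ι | t.Pairwise (· < ·) ∧ ∀ i ∈ t, i ∈ s}.Finite := by
  refine (s.powerset.image (·.sort (· ≤ ·))).finite_toSet.subset fun t ht => ?_
  rw [Finset.mem_coe, Finset.mem_image]
  exact ⟨t.toFinset, Finset.mem_powerset.2 fun i hi => ht.2 i (List.mem_toFinset.1 hi),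
    (List.toFinset_sort _ ht.1.nodup).2 (ht.1.imp le_of_lt)⟩

namespace AvoidsDescents

theorem mono (h : AvoidsDescents s L G) {s' : Finset ι} (hs : s' ⊆ s) :
    AvoidsDescents s' L {w ∈ G | ∀ i ∈ w, i ∈ s'} where
  singleton_mem i hi := h.singleton_mem i (hs hi)
  append_mem := h.append_mem
  mem_alphabet _ hw := hw.2
  mem_of_isInfix _ hw _ hvw := ⟨h.mem_of_isInfix _ hw.1 _ hvw, fun i hi => hw.2 i (hvw.subset hi)⟩
  triple_notMem u hu v hv t ht huv hvt hut hG := h.triple_notMem u hu v hv t ht huv hvt hut hG.1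

theorem exists_length_flatMap_cons_lt (h : AvoidsDescents s L G) (hmax : ∀ i ∈ s, i ≤ c)
    (hc : c ∈ s)
    (ih : ∀ s' : Finset ι, s'.card < s.card → ∀ L' G' : Set (List ι), AvoidsDescents s' L' G' →
      ∃ N, ∀ w ∈ G', w.length < N) :
    ∃ N, ∀ bs : List (List ι), (∀ t ∈ bs, c ∉ t) → bs.flatMap (List.cons c) ∈ G →
      (bs.flatMap (List.cons c)).length < N := by
  have hfin : {t : List ι | (t ++ [c]).Pairwise (· < ·) ∧ ∀ i ∈ t, i ∈ s}.Finite :=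
    (finite_pairwise_lt_of_subset s).subset fun t ht => ⟨(List.pairwise_append.1 ht.1).1, ht.2⟩
  obtain ⟨N, hN⟩ := h.exists_length_blocks_lt hmax hc ih hfin.toFinset (by simp)
  refine ⟨N * (s.card + 1), fun bs hbs hG => ?_⟩
  have htails : ∀ t ∈ bs, (t ++ [c]).Pairwise (· < ·) ∧ ∀ i ∈ t, i ∈ s := by
    intro t ht
    have hct : c :: t ∈ G := by
      obtain ⟨l, r, rfl⟩ := List.append_of_mem ht
      rw [List.flatMap_append, List.flatMap_cons, ← List.append_assoc] at hG
      exact h.mem_of_isInfix _ hG _ ⟨_, _, rfl⟩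
    exact ⟨h.pairwise_tail hmax hc (hbs t ht) hct,
      fun i hi => h.mem_alphabet _ hct i (List.mem_cons_of_mem c hi)⟩
  have hlength : ∀ t ∈ bs, t.length < s.card + 1 := fun t ht => by
    rw [← List.toFinset_card_of_nodup (List.pairwise_append.1 (htails t ht).1).1.nodup]
    exact Nat.lt_succ_of_le
      (Finset.card_le_card fun i hi => (htails t ht).2 i (List.mem_toFinset.1 hi))
  refine (length_flatMap_cons_le hlength c).trans_lt ?_
  gcongr
  exact hN bs (fun t ht => hfin.mem_toFinset.2 (htails t ht)) hG

theorem exists_length_lt (h : AvoidsDescents s L G) : ∃ N, ∀ w ∈ G, w.length < N := by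
  induction hn : s.card using Nat.strong_induction_on generalizing s L G with
  | h n ih =>
    subst hn
    replace ih (s' : Finset ι) (hs' : s'.card < s.card) (L' G' : Set (List ι))
      (h' : AvoidsDescents s' L' G') : ∃ N, ∀ w ∈ G', w.length < N := ih _ hs' h' rfl
    rcases s.eq_empty_or_nonempty with rfl | hs
    · refine ⟨1, fun w hw => ?_⟩
      simp [List.eq_nil_iff_forall_not_mem.2 fun i hi =>
        Finset.notMem_empty i (h.mem_alphabet w hw i hi)]
    have hc := s.max'_mem hs
    have hmax := s.le_max'
    obtain ⟨N₁, hN₁⟩ := ih _ (Finset.card_erase_lt_of_mem hc) _ _ (h.mono (s.erase_subset _))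
    obtain ⟨N₂, hN₂⟩ := h.exists_length_flatMap_cons_lt hmax hc ih
    refine ⟨N₁ + N₂, fun w hw => ?_⟩
    obtain ⟨p, bs, rfl, hcp, hcbs⟩ := exists_eq_append_flatMap_cons (s.max' hs) w
    have hp := hN₁ p ⟨h.mem_of_isInfix _ hw _ (List.prefix_append _ _).isInfix, fun i hi =>
      Finset.mem_erase.2 ⟨ne_of_mem_of_not_mem hi hcp, h.mem_alphabet _ hw i (by simp [hi])⟩⟩
    have hbs := hN₂ bs hcbs (h.mem_of_isInfix _ hw _ (List.suffix_append _ _).isInfix)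
    rw [List.length_append]
    exact add_lt_add hp hbs

end AvoidsDescents
end AvoidsDescents

/-! ### Commutative algebras with `x ^ 3 = 0` -/

namespace IsCubeZeroJordan

variable {K R ι : Type*} [Field K] [Ring R] [Algebra K R] [LinearOrder ι] {J : Submodule K R}
  {f : ι → R} {x y z : R} {u v t : List ι}

theorem isReducible_self_self_self (hJ : IsCubeZeroJordan J) (hx : x ∈ J)
    (hu : HasLeadingWord K f x u) : IsReducible K f (u ++ u ++ u) := by
  refine ((hu.mul hu).mul hu).isReducible ?_
  rw [hJ.cube_eq_zero x hx]
  exact zero_mem _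

theorem isReducible_self_self (hJ : IsCubeZeroJordan J) (h2 : (2 : K) ≠ 0) (hx : x ∈ J) (hy : y ∈ J)
    (hu : HasLeadingWord K f x u) (hv : HasLeadingWord K f y v) (h : v ++ u < u ++ v) :
    IsReducible K f (u ++ u ++ v) := by
  have h₁ : u ++ v ++ u < u ++ u ++ v := by simpa using List.append_left_lt (l₁ := u) h
  have h₂ : v ++ u ++ u < u ++ v ++ u := append_lt_append_of_length_eq h (by simp [add_comm]) _ _
  refine ((hu.mul hu).mul hv).isReducible ?_
  have hxxy : x * x * y = -(x * y * x + y * x * x) :=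
    eq_neg_of_add_eq_zero_left (by simpa only [add_assoc] using hJ.sq_polarization h2 hx hy)
  rw [hxxy]
  exact neg_mem <| add_mem (((hu.mul hv).mul hu).mem_lowerSpan (by simp; omega) h₁)
    (((hv.mul hu).mul hu).mem_lowerSpan (by simp; omega) (h₂.trans h₁))

theorem isReducible_append_self (hJ : IsCubeZeroJordan J) (h2 : (2 : K) ≠ 0) (hx : x ∈ J)
    (hy : y ∈ J) (hu : HasLeadingWord K f x u) (hv : HasLeadingWord K f y v)
    (h : v ++ u < u ++ v) : IsReducible K f (u ++ v ++ v) := by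
  have h₁ : v ++ u ++ v < u ++ v ++ v := append_lt_append_of_length_eq h (by simp [add_comm]) _ _
  have h₂ : v ++ v ++ u < v ++ u ++ v := by simpa using List.append_left_lt (l₁ := v) h
  refine ((hu.mul hv).mul hv).isReducible ?_
  have hxyy : x * y * y = -(y * y * x + y * x * y) :=
    eq_neg_of_add_eq_zero_right (hJ.sq_polarization h2 hy hx)
  rw [hxyy]
  exact neg_mem <| add_mem
    (((hv.mul hv).mul hu).mem_lowerSpan (by simp; omega) (h₂.trans h₁))
    (((hv.mul hu).mul hv).mem_lowerSpan (by simp; omega) h₁)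

theorem isReducible_append (hJ : IsCubeZeroJordan J) (h2 : (2 : K) ≠ 0) (hx : x ∈ J) (hy : y ∈ J)
    (hz : z ∈ J) (hu : HasLeadingWord K f x u) (hv : HasLeadingWord K f y v)
    (ht : HasLeadingWord K f z t) (huv : v ++ u < u ++ v) (hvt : t ++ v < v ++ t)
    (hut : t ++ u < u ++ t) : IsReducible K f (u ++ v ++ t) := by
  have hutv : u ++ t ++ v < u ++ v ++ t := by simpa using List.append_left_lt (l₁ := u) hvt
  have hvut : v ++ u ++ t < u ++ v ++ t :=
    append_lt_append_of_length_eq huv (by simp [add_comm]) _ _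
  have hvtu : v ++ t ++ u < v ++ u ++ t := by simpa using List.append_left_lt (l₁ := v) hut
  have htuv : t ++ u ++ v < u ++ t ++ v :=
    append_lt_append_of_length_eq hut (by simp [add_comm]) _ _
  have htvu : t ++ v ++ u < t ++ u ++ v := by simpa using List.append_left_lt (l₁ := t) huv
  refine ((hu.mul hv).mul ht).isReducible ?_
  have hxyz : x * y * z = -(x * z * y + y * x * z + y * z * x + z * x * y + z * y * x) :=
    eq_neg_of_add_eq_zero_left (by simpa only [add_assoc] using hJ.symmetrization h2 hx hy hz)
  rw [hxyz]
  refine neg_mem (add_mem (add_mem (add_mem (add_mem ?_ ?_) ?_) ?_) ?_)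
  · exact ((hu.mul ht).mul hv).mem_lowerSpan (by simp; omega) hutv
  · exact ((hv.mul hu).mul ht).mem_lowerSpan (by simp; omega) hvut
  · exact ((hv.mul ht).mul hu).mem_lowerSpan (by simp; omega) (hvtu.trans hvut)
  · exact ((ht.mul hu).mul hv).mem_lowerSpan (by simp; omega) (htuv.trans hutv)
  · exact ((ht.mul hv).mul hu).mem_lowerSpan (by simp; omega) (htvu.trans (htuv.trans hutv))

theorem avoidsDescents [Fintype ι] (hJ : IsCubeZeroJordan J) (h2 : (2 : K) ≠ 0)
    (hf : ∀ i, f i ∈ J) :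
    AvoidsDescents Finset.univ {w | ∃ x ∈ J, HasLeadingWord K f x w} {w | ¬IsReducible K f w} where
  singleton_mem i _ := ⟨f i, hf i, .singleton i⟩
  append_mem := fun u ⟨x, hx, hu⟩ v ⟨y, hy, hv⟩ h =>
    ⟨x * y + y * x, hJ.mul_add_mul_mem x hx y hy, hu.mul_add_mul hv h⟩
  mem_alphabet _ _ i _ := Finset.mem_univ i
  mem_of_isInfix := by
    rintro _ hw v ⟨u, t, rfl⟩ hv
    exact hw (hv.append u t)
  triple_notMem := by
    rintro u ⟨x, hx, hu⟩ v ⟨y, hy, hv⟩ t ⟨z, hz, ht⟩ huv hvt hut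
    rw [Set.mem_ofPred_eq, not_not]
    rcases huv with rfl | huv
    · rcases hut with rfl | hut
      · exact hJ.isReducible_self_self_self hx hu
      · exact hJ.isReducible_self_self h2 hx hz hu ht hut
    · rcases hvt with rfl | hvt
      · exact hJ.isReducible_append_self h2 hx hy hu hv huv
      · rcases hut with rfl | hut
        · exact absurd huv hvt.asymm
        · exact hJ.isReducible_append h2 hx hy hz hu hv ht huv hvt hut

theorem exists_prod_eq_zero {ι : Type*} [Finite ι] (hJ : IsCubeZeroJordan J) (h2 : (2 : K) ≠ 0)
    {f : ι → R} (hf : ∀ i, f i ∈ J) : ∃ N, ∀ w : List ι, w.length = N → (w.map f).prod = 0 := by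
  have := Fintype.ofFinite ι
  let := LinearOrder.lift' (Finite.equivFin ι) (Finite.equivFin ι).injective
  obtain ⟨N, hN⟩ := (hJ.avoidsDescents h2 hf).exists_length_lt
  refine ⟨N, prod_eq_zero_of_forall_isReducible (K := K) fun w hw => ?_⟩
  by_contra hirr
  exact (hN w hirr).ne hw

end IsCubeZeroJordan

section Monomials

variable {K A ι : Type*} [CommSemiring K] [NonUnitalNonAssocSemiring A] [Module K A]
  {g : ι → A}

/-- The subspace spanned by the values of the nonassociative monomials of degree at least `d`. -/
def degreeSpan (K : Type*) {A ι : Type*} [CommSemiring K] [NonUnitalNonAssocSemiring A] [Module K A]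
    (g : ι → A) (d : ℕ) : Submodule K A :=
  Submodule.span K (FreeMagma.lift g '' {p | d ≤ p.length})

theorem degreeSpan_anti (g : ι → A) {i j : ℕ} (h : i ≤ j) : degreeSpan K g j ≤ degreeSpan K g i :=
  Submodule.span_mono (Set.image_mono fun _ hp => h.trans hp)

variable [IsScalarTower K A A] [SMulCommClass K A A]

theorem mul_mem_degreeSpan {i j : ℕ} {x y : A} (hx : x ∈ degreeSpan K g i)
    (hy : y ∈ degreeSpan K g j) : x * y ∈ degreeSpan K g (i + j) := by
  have h := Submodule.apply_mem_map₂ (LinearMap.mul K A) hx hy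
  rw [degreeSpan, degreeSpan, Submodule.map₂_span_span] at h
  refine Submodule.span_mono ?_ h
  rintro _ ⟨_, ⟨p, hp, rfl⟩, _, ⟨q, hq, rfl⟩, rfl⟩
  exact ⟨p * q, Nat.add_le_add hp hq, map_mul _ _ _⟩

theorem degreeSpan_one_eq_top (hg : NonUnitalAlgebra.adjoin K (Set.range g) = ⊤) :
    degreeSpan K g 1 = ⊤ := by
  refine eq_top_iff.2 fun x _ => ?_
  have hx : x ∈ NonUnitalAlgebra.adjoin K (Set.range g) := hg ▸ NonUnitalAlgebra.mem_top
  induction hx using NonUnitalAlgebra.adjoin_induction with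
  | mem x hx =>
    obtain ⟨i, rfl⟩ := hx
    exact Submodule.subset_span ⟨FreeMagma.of i, Nat.le_refl 1, FreeMagma.lift_of g i⟩
  | add a b _ _ ha hb => exact add_mem (ha trivial) (hb trivial)
  | zero => exact zero_mem _
  | mul a b _ _ ha hb =>
    exact degreeSpan_anti g (Nat.le_add_left 1 1) (mul_mem_degreeSpan (ha trivial) (hb trivial))
  | smul c a _ ha => exact Submodule.smul_mem _ _ (ha trivial)

theorem productsVanish_of_adjoin_eq_top (hg : NonUnitalAlgebra.adjoin K (Set.range g) = ⊤) {N : ℕ}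
    (hN : ∀ p : FreeMagma ι, N ≤ p.length → FreeMagma.lift g p = 0) : ProductsVanish A N := by
  have hmem (p : FreeMagma A) : FreeMagma.lift id p ∈ degreeSpan K g p.length := by
    induction p with
    | ih1 a =>
      change FreeMagma.lift id (FreeMagma.of a) ∈ degreeSpan K g 1
      rw [degreeSpan_one_eq_top hg]
      trivial
    | ih2 p q hp hq =>
      rw [map_mul]
      exact mul_mem_degreeSpan hp hq
  have hbot : degreeSpan K g N = ⊥ := by
    refine Submodule.span_eq_bot.2 ?_
    rintro _ ⟨p, hp, rfl⟩
    exact hN p hp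
  exact fun p hp => (Submodule.mem_bot K).1 (hbot ▸ degreeSpan_anti g hp (hmem p))

end Monomials

theorem ProductsVanish.exists_isNilpotencyIndex {A : Type*} [Mul A] [Zero A] {N : ℕ}
    (h : ProductsVanish A N) (h1 : 1 ≤ N) : ∃ m ≤ N, IsNilpotencyIndex A m := by
  classical
  have hex : ∃ j, 1 ≤ j ∧ ProductsVanish A j := ⟨N, h1, h⟩
  exact ⟨Nat.find hex, Nat.find_min' hex ⟨h1, h⟩, Nat.find_spec hex, fun j hj =>
    Nat.find_min' hex hj⟩

section CubeZeroAlgebra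

variable {K A : Type*} [Field K] [NonUnitalNonAssocCommRing A] [Module K A]

/-- The subspace spanned by the cubes. -/
def cubeSpan (K A : Type*) [Field K] [NonUnitalNonAssocCommRing A] [Module K A] : Submodule K A :=
  Submodule.span K (Set.range fun x : A => x * x * x)

theorem cube_mem_cubeSpan (x : A) : x * x * x ∈ cubeSpan K A :=
  Submodule.subset_span ⟨x, rfl⟩

theorem cyclic_mem_cubeSpan (h2 : (2 : K) ≠ 0) (x y z : A) :
    x * y * z + y * z * x + z * x * y ∈ cubeSpan K A := by
  have h : (2 : K) • (x * y * z + y * z * x + z * x * y) =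
      (x + y + z) * (x + y + z) * (x + y + z) - (x + y) * (x + y) * (x + y)
        - (y + z) * (y + z) * (y + z) - (x + z) * (x + z) * (x + z)
        + x * x * x + y * y * y + z * z * z := by
    rw [two_smul]
    simp only [add_mul, mul_add, mul_comm y x, mul_comm z x, mul_comm z y]
    abel
  rw [← (cubeSpan K A).smul_mem_iff h2, h]
  exact add_mem (add_mem (add_mem (sub_mem (sub_mem (sub_mem (cube_mem_cubeSpan _)
    (cube_mem_cubeSpan _)) (cube_mem_cubeSpan _)) (cube_mem_cubeSpan _)) (cube_mem_cubeSpan _))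
    (cube_mem_cubeSpan _)) (cube_mem_cubeSpan _)

theorem cyclic_eq_zero (h2 : (2 : K) ≠ 0) (h : ∀ x : A, x * x * x = 0) (x y z : A) :
    x * y * z + y * z * x + z * x * y = 0 := by
  have hbot : cubeSpan K A = ⊥ := Submodule.span_eq_bot.2 (Set.forall_mem_range.2 h)
  exact (Submodule.mem_bot K).1 (hbot ▸ cyclic_mem_cubeSpan h2 x y z)

variable [SMulCommClass K A A]

theorem mulLeft_mul_of_cube_eq_zero (h2 : (2 : K) ≠ 0) (h : ∀ x : A, x * x * x = 0) (x y : A) :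
    LinearMap.mulLeft K (x * y) = -(LinearMap.mulLeft K x * LinearMap.mulLeft K y +
      LinearMap.mulLeft K y * LinearMap.mulLeft K x) := by
  ext z
  have := cyclic_eq_zero h2 h x y z
  rw [add_assoc, mul_comm (y * z), mul_comm (z * x), mul_comm z x] at this
  exact eq_neg_of_add_eq_zero_left this

theorem mulLeft_cube_of_cube_eq_zero (h2 : (2 : K) ≠ 0) (h : ∀ x : A, x * x * x = 0) (x : A) :
    LinearMap.mulLeft K x * LinearMap.mulLeft K x * LinearMap.mulLeft K x = 0 := by
  have hsq := mulLeft_mul_of_cube_eq_zero h2 h x x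
  have hcube := mulLeft_mul_of_cube_eq_zero h2 h (x * x) x
  rw [h x, LinearMap.mulLeft_zero_eq_zero, hsq] at hcube
  have h4 : (2 * 2 : K) • (LinearMap.mulLeft K x * LinearMap.mulLeft K x * LinearMap.mulLeft K x)
      = 0 := by
    rw [hcube, mul_smul, two_smul, two_smul]
    noncomm_ring
  exact (smul_eq_zero_iff_right (mul_ne_zero h2 h2)).1 h4

theorem mulLeft_lift_mem_lengthSpan (h2 : (2 : K) ≠ 0) (h : ∀ x : A, x * x * x = 0) {ι : Type*}
    (g : ι → A) (p : FreeMagma ι) : LinearMap.mulLeft K (FreeMagma.lift g p) ∈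
      lengthSpan K (fun i => LinearMap.mulLeft K (g i)) p.length := by
  induction p with
  | ih1 i =>
    have := prod_mem_lengthSpan (K := K) (f := fun i => LinearMap.mulLeft K (g i)) [i]
    rwa [List.map_singleton, List.prod_singleton] at this
  | ih2 p q hp hq =>
    rw [map_mul, mulLeft_mul_of_cube_eq_zero h2 h]
    refine neg_mem (add_mem (mul_mem_lengthSpan hp hq) ?_)
    have := mul_mem_lengthSpan hq hp
    rwa [add_comm] at this

variable [IsScalarTower K A A]

theorem isCubeZeroJordan_range_mul (h2 : (2 : K) ≠ 0) (h : ∀ x : A, x * x * x = 0) :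
    IsCubeZeroJordan (LinearMap.range (LinearMap.mul K A)) where
  mul_add_mul_mem := by
    rintro _ ⟨x, rfl⟩ _ ⟨y, rfl⟩
    rw [← neg_mem_iff]
    exact ⟨x * y, mulLeft_mul_of_cube_eq_zero h2 h x y⟩
  cube_eq_zero := by
    rintro _ ⟨x, rfl⟩
    exact mulLeft_cube_of_cube_eq_zero h2 h x

theorem exists_productsVanish_of_cube_eq_zero (h2 : (2 : K) ≠ 0) (h : ∀ x : A, x * x * x = 0)
    {ι : Type*} [Finite ι] {g : ι → A} (hg : NonUnitalAlgebra.adjoin K (Set.range g) = ⊤) :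
    ∃ N, 1 ≤ N ∧ ProductsVanish A N := by
  obtain ⟨m, hm⟩ := (isCubeZeroJordan_range_mul h2 h).exists_prod_eq_zero h2
    (f := fun i => LinearMap.mulLeft K (g i)) fun i => ⟨g i, rfl⟩
  have hzero (p : FreeMagma ι) (hp : m ≤ p.length) :
      LinearMap.mulLeft K (FreeMagma.lift g p) = 0 :=
    (Submodule.mem_bot K).1
      (lengthSpan_eq_bot (K := K) hm hp ▸ mulLeft_lift_mem_lengthSpan h2 h g p)
  refine ⟨2 * m + 2, by omega, productsVanish_of_adjoin_eq_top hg fun p hp => ?_⟩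
  cases p with
  | of i => simp [FreeMagma.length] at hp
  | mul p q =>
    change 2 * m + 2 ≤ p.length + q.length at hp
    change FreeMagma.lift g (p * q) = 0
    rw [map_mul]
    rcases le_or_gt m p.length with hmp | hmp
    · exact LinearMap.congr_fun (hzero p hmp) _
    · rw [mul_comm]
      exact LinearMap.congr_fun (hzero q (by omega)) _

end CubeZeroAlgebra

/-! ### Cubes under the identity `2 L_x ^ 3 = L_{x ^ 3}` -/

section HalfCube

variable {K A : Type*} [Field K]

theorem mem_of_nsmul_mem {M : Type*} [AddCommGroup M] [Module K M] {S : Submodule K M} {x : M}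
    {n : ℕ} (hn : (n : K) ≠ 0) (h : n • x ∈ S) : x ∈ S :=
  (S.smul_mem_iff hn).1 (by rwa [Nat.cast_smul_eq_nsmul])

/-- The difference of the two sides of the full linearization of `2 L_x ^ 3 = L_{x ^ 3}`, applied
to `w`. -/
def halfCubeDefect {A : Type*} [NonUnitalNonAssocCommRing A] (x y z w : A) : A :=
  x * (y * (z * w)) + x * (z * (y * w)) + y * (z * (x * w)) + y * (x * (z * w))
    + z * (x * (y * w)) + z * (y * (x * w)) - (x * y * z + y * z * x + z * x * y) * w

variable [NonUnitalNonAssocCommRing A]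

-- The coefficients solve the linear system that expresses the product of the cubes through the
-- consequences of `halfCubeDefect = 0` of degree three in both variables.
theorem nsmul_cube_mul_cube (x y : A) : 12 • (x * x * x * (y * y * y)) =
    (2 : ℤ) • (x * (x * halfCubeDefect y y y x))
      + (-6 : ℤ) • halfCubeDefect y x (x * y * x) y
      + (-6 : ℤ) • (y * halfCubeDefect y x (x * x) y)
      + (3 : ℤ) • halfCubeDefect y x (y * y * x) x
      + (3 : ℤ) • (x * (x * halfCubeDefect y y x y))
      + (-3 : ℤ) • (y * halfCubeDefect y y x (x * x))
      + (18 : ℤ) • (y * (y * halfCubeDefect y x x x))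
      + (-6 : ℤ) • (y * halfCubeDefect y y (x * x) x)
      + (-3 : ℤ) • halfCubeDefect y y x (x * x * y)
      + (-4 : ℤ) • halfCubeDefect y y y (x * x * x)
      + (12 : ℤ) • (y * halfCubeDefect y x (x * y) x)
      + (-6 : ℤ) • halfCubeDefect y y (x * y * x) x
      + (-6 : ℤ) • halfCubeDefect y y (x * x * y) x
      + (-6 : ℤ) • halfCubeDefect y x (x * x * y) y
      + (-3 : ℤ) • halfCubeDefect y y x (x * y * x)
      + (3 : ℤ) • (y * (x * halfCubeDefect y y x x))
      + (12 : ℤ) • halfCubeDefect y x (x * y * y) x := by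
  simp only [halfCubeDefect, mul_add, mul_sub, mul_comm]
  abel

theorem nsmul_mul_cube (x y : A) : 6 • (y * (x * x * x)) =
    3 • ((x * x * (x * y) + x * (x * y) * x + x * y * x * x)
      - (x * x * x * y + x * y * (x * x) + y * (x * x) * x))
      + (3 • halfCubeDefect x x y x - halfCubeDefect x x x y) := by
  simp only [halfCubeDefect, mul_add, mul_comm]
  abel

variable [Module K A] [IsScalarTower K A A] [SMulCommClass K A A]

namespace SatisfiesHalfCubeIdentity

theorem two_nsmul_mul_mul_mul (h : SatisfiesHalfCubeIdentity K A) (h2 : (2 : K) ≠ 0) (x w : A) :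
    2 • (x * (x * (x * w))) = x * x * x * w := by
  have hw := LinearMap.congr_fun (h x) w
  simp only [pow_succ, pow_zero, one_mul, Module.End.mul_apply, LinearMap.mulLeft_apply,
    LinearMap.smul_apply, one_div] at hw
  rwa [eq_inv_smul_iff₀ h2, ofNat_smul_eq_nsmul] at hw

theorem halfCubeDefect_eq_zero (h : SatisfiesHalfCubeIdentity K A) (h2 : (2 : K) ≠ 0)
    (x y z w : A) : halfCubeDefect x y z w = 0 := by
  let q (x : A) : A := 2 • (x * (x * (x * w))) - x * x * x * w
  have hq (x : A) : q x = 0 := sub_eq_zero.2 (h.two_nsmul_mul_mul_mul h2 x w)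
  have hpolar : 2 • halfCubeDefect x y z w =
      q (x + y + z) - q (x + y) - q (y + z) - q (x + z) + q x + q y + q z := by
    simp only [q, halfCubeDefect, add_mul, mul_add, mul_comm y x, mul_comm z x, mul_comm z y]
    abel
  refine (Submodule.mem_bot K).1 (mem_of_nsmul_mem (n := 2) (by exact_mod_cast h2) ?_)
  rw [hpolar]
  simp only [hq, sub_zero, add_zero, zero_mem]

theorem cube_mul_cube (h : SatisfiesHalfCubeIdentity K A) (h2 : (2 : K) ≠ 0) (h3 : (3 : K) ≠ 0)
    (x y : A) : x * x * x * (y * y * y) = 0 := by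
  have h12 : ((12 : ℕ) : K) ≠ 0 := by
    convert mul_ne_zero (mul_ne_zero h2 h2) h3 using 1
    norm_num
  refine (Submodule.mem_bot K).1 (mem_of_nsmul_mem h12 ?_)
  rw [nsmul_cube_mul_cube]
  simp only [h.halfCubeDefect_eq_zero h2, mul_zero, smul_zero, add_zero, zero_mem]

theorem mul_mem_cubeSpan (h : SatisfiesHalfCubeIdentity K A) (h2 : (2 : K) ≠ 0) (h3 : (3 : K) ≠ 0)
    (y : A) {c : A} (hc : c ∈ cubeSpan K A) : y * c ∈ cubeSpan K A := by
  have h6 : ((6 : ℕ) : K) ≠ 0 := by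
    convert mul_ne_zero h2 h3 using 1
    norm_num
  suffices cubeSpan K A ≤ (cubeSpan K A).comap (LinearMap.mulLeft K y) from this hc
  refine Submodule.span_le.2 (Set.range_subset_iff.2 fun x =>
    show y * (x * x * x) ∈ cubeSpan K A from mem_of_nsmul_mem h6 ?_)
  rw [nsmul_mul_cube, h.halfCubeDefect_eq_zero h2,
    h.halfCubeDefect_eq_zero h2, smul_zero, sub_zero, add_zero]
  exact nsmul_mem (sub_mem (cyclic_mem_cubeSpan h2 _ _ _) (cyclic_mem_cubeSpan h2 _ _ _)) _

theorem cubeSpan_mul_cubeSpan (h : SatisfiesHalfCubeIdentity K A) (h2 : (2 : K) ≠ 0)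
    (h3 : (3 : K) ≠ 0) {c d : A} (hc : c ∈ cubeSpan K A) (hd : d ∈ cubeSpan K A) : c * d = 0 := by
  have hcd := Submodule.apply_mem_map₂ (LinearMap.mul K A) hc hd
  rw [cubeSpan, Submodule.map₂_span_span] at hcd
  refine (Submodule.mem_bot K).1 (Submodule.span_le.2 ?_ hcd)
  rintro _ ⟨_, ⟨x, rfl⟩, _, ⟨y, rfl⟩, rfl⟩
  exact h.cube_mul_cube h2 h3 x y

theorem subsingleton_of_cubeSpan_eq_top (h : SatisfiesHalfCubeIdentity K A) (h2 : (2 : K) ≠ 0)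
    (h3 : (3 : K) ≠ 0) (htop : cubeSpan K A = ⊤) : Subsingleton A := by
  have hmem (x : A) : x ∈ cubeSpan K A := htop ▸ Submodule.mem_top
  have hcube (x : A) : x * x * x = 0 := h.cubeSpan_mul_cubeSpan h2 h3 (hmem _) (hmem _)
  have hbot : cubeSpan K A = ⊥ := Submodule.span_eq_bot.2 (Set.forall_mem_range.2 hcube)
  exact Submodule.subsingleton_iff K |>.1 (subsingleton_of_bot_eq_top (hbot.symm.trans htop))

-- Obtained by letting the linearized identity for `x, y, z`, for `x, z, w` and for `x, y, w` act on
-- `w`, `y` and `z`, respectively.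
theorem mulLeft_triple (h : SatisfiesHalfCubeIdentity K A) (h2 : (2 : K) ≠ 0) (x y z : A) :
    2 • (LinearMap.mulLeft K x * LinearMap.mulLeft K y * LinearMap.mulLeft K z)
      + 2 • (LinearMap.mulLeft K x * LinearMap.mulLeft K z * LinearMap.mulLeft K y)
      + LinearMap.mulLeft K y * LinearMap.mulLeft K x * LinearMap.mulLeft K z
      + LinearMap.mulLeft K z * LinearMap.mulLeft K x * LinearMap.mulLeft K y
      = -LinearMap.mulLeft K (x * (y * z))
        - 2 • (LinearMap.mulLeft K x * LinearMap.mulLeft K (y * z)) := by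
  ext w
  rw [← sub_eq_zero]
  have hsum : halfCubeDefect x y z w + halfCubeDefect x z w y + halfCubeDefect x y w z = 0 := by
    simp only [h.halfCubeDefect_eq_zero h2, add_zero]
  rw [← hsum]
  simp only [LinearMap.mulLeft_apply, LinearMap.neg_apply, LinearMap.add_apply,
    LinearMap.sub_apply, LinearMap.smul_apply, Module.End.mul_apply, halfCubeDefect, mul_add,
    mul_comm]
  abel

end SatisfiesHalfCubeIdentity
end HalfCube

/-! ### Words with a letter that occurs three times -/

theorem exists_eq_append_cons_of_succ_le_count {M : Type*} [DecidableEq M] {x : M} {w : List M}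
    {n : ℕ} (h : n + 1 ≤ w.count x) : ∃ s t, w = s ++ x :: t ∧ n ≤ t.count x := by
  obtain ⟨s, t, rfl, hs⟩ := List.eq_append_cons_of_mem
    (List.count_pos_iff.1 ((Nat.succ_pos n).trans_le h))
  rw [List.count_append, List.count_eq_zero_of_not_mem hs, List.count_cons_self, zero_add] at h
  exact ⟨s, t, rfl, Nat.le_of_succ_le_succ h⟩

theorem length_le_mul_card_of_count_le {M : Type*} [DecidableEq M] {c : ℕ} {w : List M}
    {T : Finset M} (hT : ∀ x ∈ w, x ∈ T) (hc : ∀ x, w.count x ≤ c) : w.length ≤ c * T.card := by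
  calc w.length = ∑ x ∈ w.toFinset, w.count x := (List.sum_toFinset_count_eq_length w).symm
    _ ≤ w.toFinset.card * c := Finset.sum_le_card_nsmul _ _ _ fun x _ => hc x
    _ ≤ T.card * c := Nat.mul_le_mul_right c
      (Finset.card_le_card fun x hx => hT x (List.mem_toFinset.1 hx))
    _ = c * T.card := Nat.mul_comm _ _

theorem sum_map_le_mul_card_of_count_le {M : Type*} [DecidableEq M] {c n : ℕ} {δ : M → ℕ}
    {w : List M} {T : Finset M} (hδ : ∀ x ∈ w, δ x ≤ n) (hT : ∀ x ∈ w, x ∈ T)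
    (hc : ∀ x, w.count x ≤ c) : (w.map δ).sum ≤ c * n * T.card := by
  calc (w.map δ).sum ≤ (w.map δ).length * n :=
        List.sum_le_card_nsmul _ _ (List.forall_mem_map.2 hδ)
    _ = w.length * n := by rw [List.length_map]
    _ ≤ c * T.card * n := Nat.mul_le_mul_right n (length_le_mul_card_of_count_le hT hc)
    _ = c * n * T.card := Nat.mul_right_comm _ _ _

section WordSpan

variable {K R M : Type*} [Field K] [Ring R] [Algebra K R]

/-- The subspace spanned by the values of the words of length at most `m` and of total degree at
least `d`, where `f x` is the value and `δ x` the degree of the letter `x`. -/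
def wordSpan (K : Type*) {R M : Type*} [Field K] [Ring R] [Algebra K R] (f : M → R) (δ : M → ℕ)
    (d m : ℕ) : Submodule K R :=
  Submodule.span K ((fun w : List M => (w.map f).prod) '' {w | w.length ≤ m ∧ d ≤ (w.map δ).sum})

variable {f : M → R} {δ : M → ℕ}

theorem wordSpan_mono {d d' m m' : ℕ} (hd : d' ≤ d) (hm : m ≤ m') :
    wordSpan K f δ d m ≤ wordSpan K f δ d' m' :=
  Submodule.span_mono (Set.image_mono fun _ hw => ⟨hw.1.trans hm, hd.trans hw.2⟩)

theorem prod_mem_wordSpan (w : List M) :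
    (w.map f).prod ∈ wordSpan K f δ (w.map δ).sum w.length :=
  Submodule.subset_span ⟨w, ⟨le_rfl, le_rfl⟩, rfl⟩

theorem letter_mem_wordSpan (x : M) : f x ∈ wordSpan K f δ (δ x) 1 := by
  simpa only [List.map_singleton, List.prod_singleton, List.sum_singleton, List.length_singleton]
    using prod_mem_wordSpan (K := K) (f := f) (δ := δ) [x]

theorem mul_mem_wordSpan {d d' m m' D N : ℕ} {a b : R} (ha : a ∈ wordSpan K f δ d m)
    (hb : b ∈ wordSpan K f δ d' m') (hD : D ≤ d + d') (hN : m + m' ≤ N) :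
    a * b ∈ wordSpan K f δ D N := by
  have h := Submodule.mul_mem_mul ha hb
  rw [wordSpan, wordSpan, Submodule.span_mul_span] at h
  refine Submodule.span_mono ?_ h
  rintro _ ⟨_, ⟨v, hv, rfl⟩, _, ⟨w, hw, rfl⟩, rfl⟩
  refine ⟨v ++ w, ⟨?_, ?_⟩, by simp only [List.map_append, List.prod_append]⟩
  · rw [List.length_append]
    exact (Nat.add_le_add hv.1 hw.1).trans hN
  · rw [List.map_append, List.sum_append]
    exact hD.trans (Nat.add_le_add hv.2 hw.2)

/-- Modulo shorter words of at least the same degree, three letters satisfy the relation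
`2 x y z + 2 x z y + y x z + z x y = 0`. -/
def ReducesTriples (K : Type*) {R M : Type*} [Field K] [Ring R] [Algebra K R] (f : M → R)
    (δ : M → ℕ) : Prop :=
  ∀ x y z : M, 2 • (f x * f y * f z) + 2 • (f x * f z * f y) + f y * f x * f z + f z * f x * f y ∈
    wordSpan K f δ (δ x + δ y + δ z) 2

namespace ReducesTriples

theorem anticommutator_comm_letter_mem (hf : ReducesTriples K f δ) (h3 : (3 : K) ≠ 0)
    (x y z : M) : (f x * f y + f y * f x) * f z - f z * (f x * f y + f y * f x) ∈
      wordSpan K f δ (δ x + δ y + δ z) 2 := by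
  refine mem_of_nsmul_mem (n := 3) (by exact_mod_cast h3) ?_
  have hy := wordSpan_mono (d' := δ x + δ y + δ z) (by omega) le_rfl (hf y z x)
  have hz := wordSpan_mono (d' := δ x + δ y + δ z) (by omega) le_rfl (hf z x y)
  convert sub_mem (add_mem (hf x y z) hy) (nsmul_mem hz 2) using 1
  noncomm_ring

theorem anticommutator_mul_letter_mem (hf : ReducesTriples K f δ) (h2 : (2 : K) ≠ 0)
    (h3 : (3 : K) ≠ 0) (x y : M) :
    (f x * f y + f y * f x) * f x + f x * f x * f y ∈ wordSpan K f δ (2 * δ x + δ y) 2 := by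
  refine mem_of_nsmul_mem (n := 2) (by exact_mod_cast h2)
    (mem_of_nsmul_mem (n := 3) (by exact_mod_cast h3) ?_)
  have hx := wordSpan_mono (d' := 2 * δ x + δ y) (by omega) le_rfl (hf x x y)
  have hy := wordSpan_mono (d' := 2 * δ x + δ y) (by omega) le_rfl (hf y x x)
  convert add_mem (nsmul_mem hx 2) hy using 1
  noncomm_ring

theorem letter_cube_mem (hf : ReducesTriples K f δ) (h2 : (2 : K) ≠ 0) (h3 : (3 : K) ≠ 0) (x : M) :
    f x * f x * f x ∈ wordSpan K f δ (3 * δ x) 2 := by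
  refine mem_of_nsmul_mem (n := 2) (by exact_mod_cast h2)
    (mem_of_nsmul_mem (n := 3) (by exact_mod_cast h3) ?_)
  convert wordSpan_mono (d' := 3 * δ x) (by omega) le_rfl (hf x x x) using 1
  noncomm_ring

theorem anticommutator_comm_prod_mem (hf : ReducesTriples K f δ) (h3 : (3 : K) ≠ 0) (x y : M)
    (w : List M) : (f x * f y + f y * f x) * (w.map f).prod
      - (w.map f).prod * (f x * f y + f y * f x) ∈
      wordSpan K f δ (δ x + δ y + (w.map δ).sum) (w.length + 1) := by
  induction w with
  | nil => simp
  | cons z w ih =>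
    rw [List.map_cons, List.map_cons, List.prod_cons, List.sum_cons, List.length_cons]
    have hsplit : (f x * f y + f y * f x) * (f z * (w.map f).prod)
        - f z * (w.map f).prod * (f x * f y + f y * f x) =
        ((f x * f y + f y * f x) * f z - f z * (f x * f y + f y * f x)) * (w.map f).prod
        + f z * ((f x * f y + f y * f x) * (w.map f).prod
          - (w.map f).prod * (f x * f y + f y * f x)) := by
      noncomm_ring
    rw [hsplit]
    exact add_mem (mul_mem_wordSpan (hf.anticommutator_comm_letter_mem h3 x y z)
        (prod_mem_wordSpan w) (by omega) (by omega))
      (mul_mem_wordSpan (letter_mem_wordSpan z) ih (by omega) (by omega))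

theorem sq_comm_prod_mem (hf : ReducesTriples K f δ) (h2 : (2 : K) ≠ 0) (h3 : (3 : K) ≠ 0) (x : M)
    (w : List M) : f x * f x * (w.map f).prod - (w.map f).prod * (f x * f x) ∈
      wordSpan K f δ (2 * δ x + (w.map δ).sum) (w.length + 1) := by
  refine mem_of_nsmul_mem (n := 2) (by exact_mod_cast h2) ?_
  convert hf.anticommutator_comm_prod_mem h3 x x w using 1
  · rw [two_mul]
  · noncomm_ring

theorem exists_letter_mul_prod_mul_letter_sub_mem (hf : ReducesTriples K f δ) (h2 : (2 : K) ≠ 0)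
    (h3 : (3 : K) ≠ 0) (x : M) (w : List M) : ∃ b ∈ wordSpan K f δ (w.map δ).sum w.length,
      f x * (w.map f).prod * f x - f x * f x * b ∈
        wordSpan K f δ (2 * δ x + (w.map δ).sum) (w.length + 1) := by
  induction w with
  | nil => exact ⟨1, prod_mem_wordSpan [], by simp⟩
  | cons y w ih =>
    obtain ⟨b, hb, hsub⟩ := ih
    rw [List.map_cons, List.map_cons, List.prod_cons, List.sum_cons, List.length_cons]
    have hw := prod_mem_wordSpan (K := K) (f := f) (δ := δ) w
    have hy := letter_mem_wordSpan (K := K) (f := f) (δ := δ) y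
    have hsq : f x * f x * f y - f y * (f x * f x) ∈ wordSpan K f δ (2 * δ x + δ y) 2 := by
      simpa using hf.sq_comm_prod_mem h2 h3 x [y]
    refine ⟨-((w.map f).prod * f y) - f y * b,
      sub_mem (neg_mem (mul_mem_wordSpan hw hy (by omega) (by omega)))
        (mul_mem_wordSpan hy hb (by omega) (by omega)), ?_⟩
    -- Move `w` to the left of `x y + y x`, then `x ^ 2` to the left of `w`.
    have hsplit : f x * (f y * (w.map f).prod) * f x
        - f x * f x * (-((w.map f).prod * f y) - f y * b) =
        ((f x * f y + f y * f x) * (w.map f).prod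
          - (w.map f).prod * (f x * f y + f y * f x)) * f x
        + (w.map f).prod * ((f x * f y + f y * f x) * f x + f x * f x * f y)
        + (f x * f x * (w.map f).prod - (w.map f).prod * (f x * f x)) * f y
        - f y * (f x * (w.map f).prod * f x - f x * f x * b)
        + (f x * f x * f y - f y * (f x * f x)) * b := by
      noncomm_ring
    rw [hsplit]
    refine add_mem (sub_mem (add_mem (add_mem ?_ ?_) ?_) ?_) ?_
    · exact mul_mem_wordSpan (hf.anticommutator_comm_prod_mem h3 x y w) (letter_mem_wordSpan x)
        (by omega) (by omega)
    · exact mul_mem_wordSpan hw (hf.anticommutator_mul_letter_mem h2 h3 x y) (by omega) (by omega)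
    · exact mul_mem_wordSpan (hf.sq_comm_prod_mem h2 h3 x w) hy (by omega) (by omega)
    · exact mul_mem_wordSpan hy hsub (by omega) (by omega)
    · exact mul_mem_wordSpan hsq hb (by omega) (by omega)

theorem exists_letter_mul_mul_letter_sub_mem (hf : ReducesTriples K f δ) (h2 : (2 : K) ≠ 0)
    (h3 : (3 : K) ≠ 0) (x : M) {d m : ℕ} {a : R} (ha : a ∈ wordSpan K f δ d m) :
    ∃ b ∈ wordSpan K f δ d m,
      f x * a * f x - f x * f x * b ∈ wordSpan K f δ (2 * δ x + d) (m + 1) := by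
  induction ha using Submodule.span_induction with
  | zero => exact ⟨0, zero_mem _, by simp⟩
  | add a a' _ _ ha ha' =>
    obtain ⟨b, hb, h⟩ := ha
    obtain ⟨b', hb', h'⟩ := ha'
    refine ⟨b + b', add_mem hb hb', ?_⟩
    convert add_mem h h' using 1
    noncomm_ring
  | smul c a _ ha =>
    obtain ⟨b, hb, h⟩ := ha
    refine ⟨c • b, Submodule.smul_mem _ c hb, ?_⟩
    rw [mul_smul_comm, smul_mul_assoc, mul_smul_comm, ← smul_sub]
    exact Submodule.smul_mem _ c h
  | mem a ha =>
    obtain ⟨w, hw, rfl⟩ := ha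
    obtain ⟨b, hb, h⟩ := hf.exists_letter_mul_prod_mul_letter_sub_mem h2 h3 x w
    exact ⟨b, wordSpan_mono hw.2 hw.1 hb,
      wordSpan_mono (Nat.add_le_add_left hw.2 _) (Nat.succ_le_succ hw.1) h⟩

theorem three_letters_mem (hf : ReducesTriples K f δ) (h2 : (2 : K) ≠ 0) (h3 : (3 : K) ≠ 0)
    (x : M) {d d' m m' : ℕ} {a b : R} (ha : a ∈ wordSpan K f δ d m)
    (hb : b ∈ wordSpan K f δ d' m') :
    f x * a * f x * b * f x ∈ wordSpan K f δ (3 * δ x + d + d') (m + m' + 2) := by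
  obtain ⟨a', ha', h⟩ := hf.exists_letter_mul_mul_letter_sub_mem h2 h3 x ha
  obtain ⟨b', hb', h'⟩ := hf.exists_letter_mul_mul_letter_sub_mem h2 h3 x
    (mul_mem_wordSpan ha' hb le_rfl le_rfl)
  have hx := letter_mem_wordSpan (K := K) (f := f) (δ := δ) x
  have hsplit : f x * a * f x * b * f x = (f x * a * f x - f x * f x * a') * (b * f x)
      + f x * (f x * (a' * b) * f x - f x * f x * b') + f x * f x * f x * b' := by
    noncomm_ring
  rw [hsplit]
  refine add_mem (add_mem ?_ ?_) ?_
  · exact mul_mem_wordSpan h (mul_mem_wordSpan hb hx le_rfl le_rfl) (by omega) (by omega)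
  · exact mul_mem_wordSpan hx h' (by omega) (by omega)
  · exact mul_mem_wordSpan (hf.letter_cube_mem h2 h3 x) hb' (by omega) (by omega)

theorem prod_mem_of_three_le_count [DecidableEq M] (hf : ReducesTriples K f δ) (h2 : (2 : K) ≠ 0)
    (h3 : (3 : K) ≠ 0) {x : M} {w : List M} (hw : 3 ≤ w.count x) :
    (w.map f).prod ∈ wordSpan K f δ (w.map δ).sum (w.length - 1) := by
  obtain ⟨s, t₁, rfl, h₁⟩ := exists_eq_append_cons_of_succ_le_count hw
  obtain ⟨u, t₂, rfl, h₂⟩ := exists_eq_append_cons_of_succ_le_count h₁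
  obtain ⟨v, t, rfl, -⟩ := exists_eq_append_cons_of_succ_le_count h₂
  have h := mul_mem_wordSpan (prod_mem_wordSpan s) (mul_mem_wordSpan (hf.three_letters_mem h2 h3 x
    (prod_mem_wordSpan u) (prod_mem_wordSpan v)) (prod_mem_wordSpan t) le_rfl le_rfl) le_rfl le_rfl
  convert wordSpan_mono ?_ ?_ h using 1
  · simp only [List.map_append, List.map_cons, List.prod_append, List.prod_cons, mul_assoc]
  · simp only [List.map_append, List.map_cons, List.sum_append, List.sum_cons]
    omega
  · simp only [List.length_append, List.length_cons]
    omega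

theorem prod_mem (hf : ReducesTriples K f δ) (h2 : (2 : K) ≠ 0) (h3 : (3 : K) ≠ 0) {n : ℕ}
    {T : Finset M} (hT : ∀ x, δ x ≤ n → x ∈ T) {S : Submodule K R}
    (hS : ∀ w : List M, (∃ x ∈ w, n < δ x) → (w.map f).prod ∈ S) (w : List M)
    (hw : 2 * n * T.card < (w.map δ).sum) : (w.map f).prod ∈ S := by
  classical
  induction hl : w.length using Nat.strong_induction_on generalizing w with
  | _ l ih =>
    by_cases hlong : ∃ x ∈ w, n < δ x
    · exact hS w hlong
    push Not at hlong
    obtain ⟨x, hx⟩ : ∃ x, 2 < w.count x := by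
      by_contra! hcount
      exact hw.not_ge (sum_map_le_mul_card_of_count_le hlong (fun x hx => hT x (hlong x hx)) hcount)
    have hpos : 0 < w.length := by
      have := List.count_le_length (a := x) (l := w)
      omega
    suffices wordSpan K f δ (w.map δ).sum (w.length - 1) ≤ S from
      this (hf.prod_mem_of_three_le_count h2 h3 hx)
    refine Submodule.span_le.2 ?_
    rintro _ ⟨v, ⟨hv, hδ⟩, rfl⟩
    exact ih v.length (by omega) v (hw.trans_le hδ) rfl

end ReducesTriples
end WordSpan

/-! ### Free algebras and the nilpotency bound -/

theorem lift_mem_adjoin {K A ι : Type*} [CommSemiring K] [NonUnitalNonAssocSemiring A] [Module K A]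
    [IsScalarTower K A A] [SMulCommClass K A A] (g : ι → A) (p : FreeMagma ι) :
    FreeMagma.lift g p ∈ NonUnitalAlgebra.adjoin K (Set.range g) := by
  induction p with
  | ih1 i => exact NonUnitalAlgebra.subset_adjoin K ⟨i, FreeMagma.lift_of g i⟩
  | ih2 p q hp hq =>
    rw [map_mul]
    exact mul_mem hp hq

theorem ProductsVanish.lift_eq_zero {A ι : Type*} [Mul A] [Zero A] {n : ℕ}
    (h : ProductsVanish A n) (g : ι → A) {p : FreeMagma ι} (hp : n ≤ p.length) :
    FreeMagma.lift g p = 0 := by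
  have hlength (p : FreeMagma ι) : (FreeMagma.map g p).length = p.length := by
    induction p with
    | ih1 i => rfl
    | ih2 p q hp hq =>
      rw [map_mul]
      exact congrArg₂ (· + ·) hp hq
  have hlift : (FreeMagma.lift id).comp (FreeMagma.map g) = FreeMagma.lift g :=
    FreeMagma.hom_ext rfl
  rw [← hlift]
  exact h _ ((hlength p).symm ▸ hp)

namespace CommMonomial

variable {X : Type*}

/-- The monomial of a nonassociative word. -/
def mk (p : FreeMagma X) : CommMonomial X := (p : (commCon X).Quotient)

theorem mk_surjective : Function.Surjective (mk : FreeMagma X → CommMonomial X) :=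
  Quotient.mk''_surjective

theorem mk_mul (p q : FreeMagma X) : mk (p * q) = mk p * mk q := rfl

theorem degree_mul (a b : CommMonomial X) : (a * b).degree = a.degree + b.degree := by
  obtain ⟨p, rfl⟩ := mk_surjective a
  obtain ⟨q, rfl⟩ := mk_surjective b
  rfl

theorem degree_pos (a : CommMonomial X) : 0 < a.degree := by
  obtain ⟨p, rfl⟩ := mk_surjective a
  exact p.length_pos

theorem commCon_le_ker_lift {M : Type*} [CommMagma M] (g : X → M) :
    commCon X ≤ Con.ker (FreeMagma.lift g) := by
  refine Con.conGen_le.2 ?_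
  rintro _ _ ⟨p, q, rfl, rfl⟩
  rw [Con.ker_rel, map_mul, map_mul, mul_comm]

/-- The value of a monomial at a family of elements of a commutative magma. -/
def eval {M : Type*} [CommMagma M] (g : X → M) : CommMonomial X →ₙ* M where
  toFun m := Con.liftOn m (FreeMagma.lift g) fun _ _ h => commCon_le_ker_lift g h
  map_mul' a b := by
    obtain ⟨p, rfl⟩ := mk_surjective a
    obtain ⟨q, rfl⟩ := mk_surjective b
    exact map_mul (FreeMagma.lift g) p q

theorem finite_degree_le [Finite X] (n : ℕ) : {m : CommMonomial X | m.degree ≤ n}.Finite := by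
  induction n with
  | zero => exact Set.finite_empty.subset fun m hm => m.degree_pos.not_ge hm
  | succ n ih =>
    refine ((Set.finite_range fun i : X => mk (FreeMagma.of i)).union
      (Set.Finite.image2 (· * ·) ih ih)).subset ?_
    intro m hm
    obtain ⟨p, rfl⟩ := mk_surjective m
    cases p with
    | of i => exact .inl ⟨i, rfl⟩
    | mul p q =>
      have hp := p.length_pos
      have hq := q.length_pos
      change p.length + q.length ≤ n + 1 at hm
      exact .inr ⟨mk p, show p.length ≤ n by omega, mk q, show q.length ≤ n by omega, rfl⟩

end CommMonomial

theorem dimBelow_succ_eq_card (K : Type*) [Field K] (n k : ℕ) :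
    dimBelow K (n + 1) k = (CommMonomial.finite_degree_le (X := Fin k) n).toFinset.card := by
  have hset : {m : CommMonomial (Fin k) | m.degree < n + 1} = {m | m.degree ≤ n} :=
    Set.ext fun m => Nat.lt_succ_iff
  have hfin := CommMonomial.finite_degree_le (X := Fin k) n
  have : Fintype {m : CommMonomial (Fin k) | m.degree ≤ n} := hfin.fintype
  have hind : LinearIndependent K (fun m : {m : CommMonomial (Fin k) | m.degree ≤ n} =>
      (MonoidAlgebra.single m.1 1 : FreeCommAlgebra K (Fin k))) :=
    (MonoidAlgebra.basis (CommMonomial (Fin k)) K).linearIndependent.comp _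
      Subtype.val_injective
  rw [dimBelow, hset, Set.image_eq_range, finrank_span_eq_card hind, Set.Finite.card_toFinset]

theorem lt_degree_of_dimBelow_succ_eq_zero {K : Type*} [Field K] {n k : ℕ}
    (h : dimBelow K (n + 1) k = 0) (m : CommMonomial (Fin k)) : n < m.degree := by
  by_contra! hm
  rw [dimBelow_succ_eq_card, Finset.card_eq_zero] at h
  have hmem := (CommMonomial.finite_degree_le n).mem_toFinset.2 hm
  exact Finset.notMem_empty m (h ▸ hmem)

namespace FreeCubeZeroAlgebra

variable {K X : Type*} [Field K]

theorem cube_eq_zero (x : FreeCubeZeroAlgebra K X) : x * x * x = 0 := by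
  obtain ⟨x, rfl⟩ := Submodule.Quotient.mk_surjective _ x
  rw [← mk_mul, ← mk_mul, Submodule.Quotient.mk_eq_zero]
  exact Submodule.mem_sInf.2 fun I hI => hI.2 x

/-- The free generators. -/
noncomputable def gen (K : Type*) {X : Type*} [Field K] (i : X) : FreeCubeZeroAlgebra K X :=
  Submodule.Quotient.mk (MonoidAlgebra.single (CommMonomial.mk (FreeMagma.of i)) 1)

theorem lift_gen (p : FreeMagma X) : FreeMagma.lift (gen K) p =
    (Submodule.Quotient.mk (MonoidAlgebra.single (CommMonomial.mk p) 1) :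
      FreeCubeZeroAlgebra K X) := by
  induction p with
  | ih1 i => rfl
  | ih2 p q hp hq =>
    rw [map_mul, hp, hq, ← mk_mul, MonoidAlgebra.single_mul_single, mul_one,
      CommMonomial.mk_mul]

theorem adjoin_range_gen :
    NonUnitalAlgebra.adjoin K (Set.range (gen K : X → FreeCubeZeroAlgebra K X)) = ⊤ := by
  refine eq_top_iff.2 fun x _ => ?_
  obtain ⟨x, rfl⟩ := Submodule.Quotient.mk_surjective _ x
  induction x using MonoidAlgebra.induction_linear with
  | zero => exact zero_mem _
  | add a b ha hb => exact add_mem (ha trivial) (hb trivial)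
  | single m r =>
    obtain ⟨p, rfl⟩ := CommMonomial.mk_surjective m
    have hsingle : (MonoidAlgebra.single (CommMonomial.mk p) r : FreeCommAlgebra K X) =
        r • MonoidAlgebra.single (CommMonomial.mk p) 1 := by
      rw [MonoidAlgebra.smul_single, smul_eq_mul, mul_one]
    rw [hsingle, Submodule.Quotient.mk_smul, ← lift_gen]
    exact SMulMemClass.smul_mem r (lift_mem_adjoin (gen K) p)

theorem exists_isNilpotencyIndex [Finite X] (h2 : (2 : K) ≠ 0) :
    ∃ n, IsNilpotencyIndex (FreeCubeZeroAlgebra K X) n := by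
  obtain ⟨N, h1, hN⟩ := exists_productsVanish_of_cube_eq_zero h2 cube_eq_zero
    (adjoin_range_gen (K := K) (X := X))
  obtain ⟨n, -, hn⟩ := hN.exists_isNilpotencyIndex h1
  exact ⟨n, hn⟩

theorem single_mem_cubeIdeal {n : ℕ} (h : ProductsVanish (FreeCubeZeroAlgebra K X) n)
    {m : CommMonomial X} (hm : n ≤ m.degree) :
    (MonoidAlgebra.single m 1 : FreeCommAlgebra K X) ∈ cubeIdeal K X := by
  obtain ⟨p, rfl⟩ := CommMonomial.mk_surjective m
  rw [← Submodule.Quotient.mk_eq_zero, ← lift_gen]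
  exact h.lift_eq_zero (gen K) hm

end FreeCubeZeroAlgebra

section SquareZeroOperators

variable {R M : Type*} [CommSemiring R] [AddCommMonoid M] [Module R M] {S : Submodule R M}

/-- The operators that map the module into `S` and annihilate `S`; any two of them have product
zero. -/
def squareZeroOperators (S : Submodule R M) : Submodule R (Module.End R M) :=
  Submodule.compatibleMaps ⊤ S ⊓ Submodule.compatibleMaps S ⊥

theorem mem_squareZeroOperators {T : Module.End R M} :
    T ∈ squareZeroOperators S ↔ (∀ a, T a ∈ S) ∧ ∀ c ∈ S, T c = 0 :=
  ⟨fun h => ⟨fun _ => h.1 trivial, fun _ hc => h.2 hc⟩, fun h => ⟨fun a _ => h.1 a, h.2⟩⟩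

theorem mul_eq_zero_of_mem_squareZeroOperators {T U : Module.End R M}
    (hT : T ∈ squareZeroOperators S) (hU : U ∈ squareZeroOperators S) : T * U = 0 :=
  LinearMap.ext fun a =>
    (mem_squareZeroOperators.1 hT).2 _ ((mem_squareZeroOperators.1 hU).1 a)

theorem list_prod_apply_mem {l : List (Module.End R M)} (hl : ∀ T ∈ l, ∀ c ∈ S, T c ∈ S) {c : M}
    (hc : c ∈ S) : l.prod c ∈ S := by
  induction l with
  | nil => exact hc
  | cons T l ih =>
    rw [List.forall_mem_cons] at hl
    rw [List.prod_cons]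
    exact hl.1 _ (ih hl.2)

theorem list_prod_mem_squareZeroOperators {l : List (Module.End R M)}
    (hl : ∀ T ∈ l, ∀ c ∈ S, T c ∈ S) {T : Module.End R M} (hT : T ∈ l)
    (hTS : T ∈ squareZeroOperators S) : l.prod ∈ squareZeroOperators S := by
  obtain ⟨s, t, rfl⟩ := List.append_of_mem hT
  rw [List.forall_mem_append, List.forall_mem_cons] at hl
  rw [mem_squareZeroOperators] at hTS ⊢
  rw [List.prod_append, List.prod_cons]
  refine ⟨fun a => list_prod_apply_mem hl.1 (hTS.1 _), fun c hc => ?_⟩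
  rw [Module.End.mul_apply, Module.End.mul_apply, hTS.2 _ (list_prod_apply_mem hl.2.2 hc), map_zero]

end SquareZeroOperators

theorem exists_lift_eq_prod_apply {K A X : Type*} [CommSemiring K] [NonUnitalNonAssocCommSemiring A]
    [Module K A] [SMulCommClass K A A] (g : X → A) (N : ℕ) (p : FreeMagma X)
    (hp : 2 ^ N ≤ p.length) : ∃ w : List (CommMonomial X), w.length = N ∧ ∃ a : A,
      FreeMagma.lift g p =
        (w.map fun m => LinearMap.mulLeft K (CommMonomial.eval g m)).prod a := by
  induction N generalizing p with
  | zero => exact ⟨[], rfl, FreeMagma.lift g p, rfl⟩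
  | succ N ih =>
    cases p with
    | of i => exact absurd hp (Nat.one_lt_two_pow (Nat.succ_ne_zero N)).not_ge
    | mul p q =>
      change 2 ^ (N + 1) ≤ p.length + q.length at hp
      change ∃ w : List (CommMonomial X), w.length = N + 1 ∧ ∃ a : A, FreeMagma.lift g (p * q) = _
      rw [map_mul]
      rcases le_total q.length p.length with h | h
      · obtain ⟨w, hw, a, ha⟩ := ih p (by omega)
        refine ⟨CommMonomial.mk q :: w, congrArg Nat.succ hw, a, ?_⟩
        rw [ha, mul_comm]
        rfl
      · obtain ⟨w, hw, a, ha⟩ := ih q (by omega)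
        refine ⟨CommMonomial.mk p :: w, congrArg Nat.succ hw, a, ?_⟩
        rw [ha]
        rfl

theorem adjoin_range_subtype_eq_top {K A : Type*} [CommSemiring K] [NonUnitalNonAssocSemiring A]
    [Module K A] [IsScalarTower K A A] [SMulCommClass K A A] (s : Set A) :
    NonUnitalAlgebra.adjoin K (Set.range fun x : s =>
      (⟨x, NonUnitalAlgebra.subset_adjoin K x.2⟩ : NonUnitalAlgebra.adjoin K s)) = ⊤ := by
  refine eq_top_iff.2 ?_
  rintro ⟨x, hx⟩ -
  induction hx using NonUnitalAlgebra.adjoin_induction with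
  | mem x hx => exact NonUnitalAlgebra.subset_adjoin K ⟨⟨x, hx⟩, rfl⟩
  | add x y _ _ hx hy => exact add_mem hx hy
  | zero => exact zero_mem _
  | mul x y _ _ hx hy => exact mul_mem hx hy
  | smul r x _ hx => exact SMulMemClass.smul_mem r hx

section HalfCubeNilpotency

variable {K A : Type*} [Field K] [NonUnitalNonAssocCommRing A] [Module K A]
  [IsScalarTower K A A] [SMulCommClass K A A]

theorem isGeneratedBy_adjoin (s : Finset A) :
    IsGeneratedBy K (NonUnitalAlgebra.adjoin K (s : Set A)) s.card := by
  refine ⟨fun i => ⟨s.equivFin.symm i, NonUnitalAlgebra.subset_adjoin K (s.equivFin.symm i).2⟩, ?_⟩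
  rw [← adjoin_range_subtype_eq_top (K := K) (s : Set A)]
  exact congrArg _ (s.equivFin.symm.surjective.range_comp fun x : s =>
    (⟨x, NonUnitalAlgebra.subset_adjoin K x.2⟩ : NonUnitalAlgebra.adjoin K (s : Set A)))

namespace SatisfiesHalfCubeIdentity

theorem nonUnitalSubalgebra (h : SatisfiesHalfCubeIdentity K A) (B : NonUnitalSubalgebra K A) :
    SatisfiesHalfCubeIdentity K B := fun x => by
  ext y
  simpa [pow_succ] using LinearMap.congr_fun (h x) y

theorem mulLeft_mem_squareZeroOperators (h : SatisfiesHalfCubeIdentity K A) (h2 : (2 : K) ≠ 0)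
    (h3 : (3 : K) ≠ 0) {c : A} (hc : c ∈ cubeSpan K A) :
    LinearMap.mulLeft K c ∈ squareZeroOperators (cubeSpan K A) := by
  refine mem_squareZeroOperators.2 ⟨fun a => ?_, fun d hd => h.cubeSpan_mul_cubeSpan h2 h3 hc hd⟩
  rw [LinearMap.mulLeft_apply, mul_comm]
  exact h.mul_mem_cubeSpan h2 h3 a hc

theorem reducesTriples_eval (h : SatisfiesHalfCubeIdentity K A) (h2 : (2 : K) ≠ 0) {X : Type*}
    (g : X → A) : ReducesTriples K (fun m => LinearMap.mulLeft K (CommMonomial.eval g m))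
      (CommMonomial.degree : CommMonomial X → ℕ) := by
  intro x y z
  have hletter (m : CommMonomial X) : LinearMap.mulLeft K (CommMonomial.eval g m) ∈
      wordSpan K (fun m => LinearMap.mulLeft K (CommMonomial.eval g m)) CommMonomial.degree
        m.degree 1 := letter_mem_wordSpan m
  have hd := CommMonomial.degree_mul y z
  have hd' := CommMonomial.degree_mul x (y * z)
  have hxyz := wordSpan_mono (d' := x.degree + y.degree + z.degree) (by omega) one_le_two
    (hletter (x * (y * z)))
  have hx_yz := mul_mem_wordSpan (D := x.degree + y.degree + z.degree) (hletter x)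
    (hletter (y * z)) (by omega) le_rfl
  rw [map_mul, map_mul] at hxyz
  rw [map_mul] at hx_yz
  rw [h.mulLeft_triple h2]
  exact sub_mem (neg_mem hxyz) (nsmul_mem hx_yz 2)

theorem eval_mem_cubeSpan (h : SatisfiesHalfCubeIdentity K A) (h2 : (2 : K) ≠ 0) (h3 : (3 : K) ≠ 0)
    {X : Type*} (g : X → A) {m : CommMonomial X}
    (hm : (MonoidAlgebra.single m 1 : FreeCommAlgebra K X) ∈ cubeIdeal K X) :
    CommMonomial.eval g m ∈ cubeSpan K A := by
  let φ : FreeCommAlgebra K X →ₙₐ[K] A := MonoidAlgebra.liftMagma K (CommMonomial.eval g)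
  have hφ : φ (MonoidAlgebra.single m 1) = CommMonomial.eval g m :=
    DFunLike.congr_fun ((MonoidAlgebra.liftMagma K).symm_apply_apply (CommMonomial.eval g)) m
  rw [← hφ]
  refine Submodule.mem_sInf.1 hm ((cubeSpan K A).comap (φ : FreeCommAlgebra K X →ₗ[K] A)) ⟨?_, ?_⟩
  · intro a x hx
    change φ (a * x) ∈ cubeSpan K A
    rw [map_mul]
    exact h.mul_mem_cubeSpan h2 h3 _ hx
  · intro x
    change φ (x * x * x) ∈ cubeSpan K A
    rw [map_mul, map_mul]
    exact cube_mem_cubeSpan _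

theorem subsingleton_of_forall_single_mem (h : SatisfiesHalfCubeIdentity K A) (h2 : (2 : K) ≠ 0)
    (h3 : (3 : K) ≠ 0) {X : Type*} {g : X → A} (hg : NonUnitalAlgebra.adjoin K (Set.range g) = ⊤)
    (hX : ∀ m : CommMonomial X, MonoidAlgebra.single m 1 ∈ cubeIdeal K X) : Subsingleton A := by
  refine h.subsingleton_of_cubeSpan_eq_top h2 h3 (top_unique ?_)
  rw [← degreeSpan_one_eq_top hg]
  refine Submodule.span_le.2 ?_
  rintro _ ⟨p, -, rfl⟩
  exact h.eval_mem_cubeSpan h2 h3 g (hX (CommMonomial.mk p))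

theorem prod_mulLeft_eval_mem (h : SatisfiesHalfCubeIdentity K A) (h2 : (2 : K) ≠ 0)
    (h3 : (3 : K) ≠ 0) {n k : ℕ} (hn : ProductsVanish (FreeCubeZeroAlgebra K (Fin k)) (n + 1))
    (g : Fin k → A) (w : List (CommMonomial (Fin k)))
    (hw : 2 * n * dimBelow K (n + 1) k < w.length) :
    (w.map fun m => LinearMap.mulLeft K (CommMonomial.eval g m)).prod ∈
      squareZeroOperators (cubeSpan K A) := by
  refine (h.reducesTriples_eval h2 g).prod_mem h2 h3
    (fun m hm => (CommMonomial.finite_degree_le n).mem_toFinset.2 hm) ?_ w ?_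
  · rintro w ⟨m, hmw, hm⟩
    refine list_prod_mem_squareZeroOperators ?_ (List.mem_map_of_mem hmw)
      (h.mulLeft_mem_squareZeroOperators h2 h3 (h.eval_mem_cubeSpan h2 h3 g
        (FreeCubeZeroAlgebra.single_mem_cubeIdeal hn hm)))
    exact List.forall_mem_map.2 fun x _ c hc => h.mul_mem_cubeSpan h2 h3 _ hc
  · rw [← dimBelow_succ_eq_card K]
    refine hw.trans_le ?_
    rw [← List.length_map (as := w) CommMonomial.degree]
    exact List.length_le_sum_of_one_le _ (List.forall_mem_map.2 fun m _ => m.degree_pos)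

theorem productsVanish (h : SatisfiesHalfCubeIdentity K A) (h2 : (2 : K) ≠ 0) (h3 : (3 : K) ≠ 0)
    {n k : ℕ} (hn : IsNilpotencyIndex (FreeCubeZeroAlgebra K (Fin k)) n)
    (hA : IsGeneratedBy K A k) : ProductsVanish A (2 ^ (4 * n * dimBelow K n k)) := by
  obtain ⟨g, hg⟩ := hA
  obtain ⟨⟨h1, hvanish⟩, -⟩ := hn
  obtain ⟨n, rfl⟩ := Nat.exists_eq_add_of_le' h1
  rcases Nat.eq_zero_or_pos (dimBelow K (n + 1) k) with hD | hD
  · have := h.subsingleton_of_forall_single_mem h2 h3 hg fun m =>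
      FreeCubeZeroAlgebra.single_mem_cubeIdeal hvanish (lt_degree_of_dimBelow_succ_eq_zero hD m)
    exact fun p _ => Subsingleton.elim _ _
  refine productsVanish_of_adjoin_eq_top hg fun p hp => ?_
  obtain ⟨w, hw, a, ha⟩ := exists_lift_eq_prod_apply (K := K) g _ p hp
  obtain ⟨m, hm⟩ : ∃ m, m = 2 * (n + 1) * dimBelow K (n + 1) k := ⟨_, rfl⟩
  have hlength : w.length = m + m := by
    rw [hw, hm]
    ring
  have hlt : 2 * n * dimBelow K (n + 1) k < m := by
    rw [hm]
    gcongr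
    exact n.lt_succ_self
  have htake := h.prod_mulLeft_eval_mem h2 h3 hvanish g (w.take m)
    (by rwa [List.length_take, hlength, min_eq_left (Nat.le_add_left m m)])
  have hdrop := h.prod_mulLeft_eval_mem h2 h3 hvanish g (w.drop m)
    (by rwa [List.length_drop, hlength, Nat.add_sub_cancel])
  rw [ha, ← List.take_append_drop m w, List.map_append, List.prod_append,
    mul_eq_zero_of_mem_squareZeroOperators htake hdrop, LinearMap.zero_apply]

theorem exists_isNilpotencyIndex_le (h : SatisfiesHalfCubeIdentity K A) (h2 : (2 : K) ≠ 0)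
    (h3 : (3 : K) ≠ 0) {n k : ℕ} (hn : IsNilpotencyIndex (FreeCubeZeroAlgebra K (Fin k)) n)
    (hA : IsGeneratedBy K A k) :
    ∃ m ≤ 2 ^ (4 * n * dimBelow K n k), IsNilpotencyIndex A m :=
  (h.productsVanish h2 h3 hn hA).exists_isNilpotencyIndex Nat.one_le_two_pow

theorem isLocallyNilpotentAlgebra (h : SatisfiesHalfCubeIdentity K A) (h2 : (2 : K) ≠ 0)
    (h3 : (3 : K) ≠ 0) : IsLocallyNilpotentAlgebra K A := fun s => by
  obtain ⟨n, hn⟩ := FreeCubeZeroAlgebra.exists_isNilpotencyIndex (X := Fin s.card) h2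
  obtain ⟨m, -, hm⟩ := (h.nonUnitalSubalgebra _).exists_isNilpotencyIndex_le h2 h3 hn
    (isGeneratedBy_adjoin s)
  exact ⟨m, hm⟩

end SatisfiesHalfCubeIdentity
end HalfCubeNilpotency

theorem three_ne_zero_of_ringChar_ne_three {K : Type*} [NonAssocRing K] [Nontrivial K]
    (h3 : ringChar K ≠ 3) : (3 : K) ≠ 0 := fun h0 => by
  have h : ringChar K ∣ 3 := (ringChar.spec K 3).1 (by exact_mod_cast h0)
  rcases (Nat.dvd_prime Nat.prime_three).1 h with h1 | h1
  · exact CharP.ringChar_ne_one h1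
  · exact h3 h1

theorem theorem7 {K : Type u} [Field K] (h2 : ringChar K ≠ 2) (h3 : ringChar K ≠ 3) :
    (∀ (A : Type v) [NonUnitalNonAssocCommRing A] [Module K A] [IsScalarTower K A A]
        [SMulCommClass K A A],
        SatisfiesHalfCubeIdentity K A → IsLocallyNilpotentAlgebra K A) ∧
    (∀ k : ℕ, ∃ n : ℕ, IsNilpotencyIndex (FreeCubeZeroAlgebra K (Fin k)) n ∧
      ∀ (A : Type w) [NonUnitalNonAssocCommRing A] [Module K A] [IsScalarTower K A A]
        [SMulCommClass K A A],
        SatisfiesHalfCubeIdentity K A → IsGeneratedBy K A k →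
          ∃ m : ℕ, m ≤ 2 ^ (4 * n * dimBelow K n k) ∧ IsNilpotencyIndex A m) := by
  have h2' : (2 : K) ≠ 0 := Ring.two_ne_zero h2
  have h3' : (3 : K) ≠ 0 := three_ne_zero_of_ringChar_ne_three h3
  refine ⟨fun A _ _ _ _ h => h.isLocallyNilpotentAlgebra h2' h3', fun k => ?_⟩
  obtain ⟨n, hn⟩ := FreeCubeZeroAlgebra.exists_isNilpotencyIndex (X := Fin k) h2'
  exact ⟨n, hn, fun A _ _ _ _ h hA => h.exists_isNilpotencyIndex_le h2' h3' hn hA⟩
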